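/- Let $\Lambda_+=\{z\in\mathbb Z+i\mathbb Z:\Re z\ge 0\}$. A function $f:\Lambda_+\to\mathbb C$ is discrete analytic if $\frac{f(z+1+i)-f(z)}{1+i}=\frac{f(z+1)-f(z+i)}{1-i}$ for all $z\in\Lambda_+$. Put $(\delta_xf)(z)=f(z+1)-f(z)$ and $(Zf)(z)=\frac{f(0)-f(z)}2+\int_0^z f\,\delta z$, where $\int_\gamma f\,\delta z=\sum_{k=1}^n\frac{f(z_{k-1})+f(z_k)}2(z_k-z_{k-1})$ for a lattice path $\gamma=(z_0,\dots,z_n)$ in $\Lambda_+$ with $|z_k-z_{k-1}|=1$ (for discrete analytic $f$ the integral from $0$ to $z$ does not depend on the path). Let $z^{(n)}=(Z^n1)(z)$ and $\hat f(n)=(\delta_x^nf)(0)$. The Hardy space $\mathbf H_2(\Lambda_+)$ consists of the discrete analytic functions $f(z)=\sum_{n\ge0}\hat f(n)z^{(n)}$ on $\Lambda_+$ with $\|f\|^2=\sum_n|\hat f(n)|^2<\infty$. The convolution product is $$(s\odot f)(z)=\sum_{n\ge0}\Big(\sum_{m=0}^n\hat s(m)\hat f(n-m)\Big)z^{(n)},$$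 with powers $f^{\odot 0}=1$, $f^{\odot(k+1)}=f\odot f^{\odot k}$, and $M_sf=s\odot f$. A discrete analytic function $s$ on $\Lambda_+$ is a discrete analytic Schur function if $\sum_n|(Z^ns)(z)|^2<\infty$ for every $z\in\Lambda_+$ and the kernel $K^s_w(z)=\sum_{n\ge0}\big(z^{(n)}\overline{w^{(n)}}-(Z^ns)(z)\overline{(Z^ns)(w)}\big)$ is positive semidefinite on $\Lambda_+$. Let $\alpha_\pm=\frac{1\pm i}2$ and, for $|a|<1$, let $(1-az)^{-\odot}=(1+a)^{\Re z}\Big(\frac{1+\alpha_+a}{1+\alpha_-a}\Big)^{\Im z}$. The Blaschke factors are $$\mathcal B_\pm(z)=\alpha_\mp+\alpha_\pm\, z\odot(1+\alpha_\pm z)^{-\odot}\,\alpha_\mp .$$ For $\lambda\in\Lambda_+$ let $R_\lambda=\{z\in\Lambda_+:\Re z\le\Re\lambda,\ |\Im z|\le|\Im\lambda|,\ \Im z\,\Im\lambda\ge0\}$. **Theorem.** Let $\lambda\in\Lambda_+$ and $B:\Lambda_+\to\mathbb C$. The following are equivalent: 1. $B$ is a discrete analytic Schur function, $M_B$ maps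 $\mathbf H_2(\Lambda_+)$ isometrically into itself, and $$B\odot\mathbf H_2(\Lambda_+)=\{f\in\mathbf H_2(\Lambda_+): f(z)=0\text{ for all }z\in R_\lambda\};$$ 2. there is a constant $c\in\mathbb C$ with $|c|=1$ such that $$B=c\; z^{(\Re\lambda+1)}\odot\mathcal B_\pm^{\odot|\Im\lambda|},$$ where the sign is $+$ if $\Im\lambda\ge0$ and $-$ otherwise. In particular, a function $\mathcal B_\lambda=B$ as in 1 exists, is unique up to a unimodular constant, and is given by 2. -/

import Mathlib

open scoped ComplexOrder

noncomputable section

namespace DiscreteAnalytic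

/-! ### The half-lattice and discrete analytic functions -/

/-- The lattice `Λ = ℤ + iℤ`. -/
abbrev Lat : Type := GaussianInt

/-- The half-lattice `Λ₊ = {z ∈ Λ : Re z ≥ 0}`. -/
abbrev LatPlus : Type := {z : Lat // 0 ≤ z.re}

namespace LatPlus

/-- The real part, an integer. -/
def re (z : LatPlus) : ℤ := z.1.re

/-- The imaginary part, an integer. -/
def im (z : LatPlus) : ℤ := z.1.im

/-- The lattice point as a complex number. -/
def toC (z : LatPlus) : ℂ := GaussianInt.toComplex z.1

/-- The origin. -/
def origin : LatPlus := ⟨⟨0, 0⟩, le_refl 0⟩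

/-- `z + 1`. -/
def east (z : LatPlus) : LatPlus := ⟨⟨z.1.re + 1, z.1.im⟩, add_nonneg z.2 zero_le_one⟩

/-- `z + i`. -/
def north (z : LatPlus) : LatPlus := ⟨⟨z.1.re, z.1.im + 1⟩, z.2⟩

end LatPlus

open LatPlus

/-- Discrete analyticity on `Λ₊`:
`(f(z+1+i) - f(z)) / (1+i) = (f(z+1) - f(z+i)) / (1-i)` for all `z ∈ Λ₊`. -/
def IsDiscreteAnalytic (f : LatPlus → ℂ) : Prop :=
  ∀ z : LatPlus,
    (f z.east.north - f z) / (1 + Complex.I) = (f z.east - f z.north) / (1 - Complex.I)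

/-! ### Discrete integration and the operators `Z` and `δₓ` -/

/-- `γ 0, …, γ n` is a path in `Λ₊`: consecutive points are at distance `1`. -/
def IsPath (n : ℕ) (γ : ℕ → LatPlus) : Prop :=
  ∀ k < n, ‖(γ (k + 1)).toC - (γ k).toC‖ = 1

/-- The discrete integral of `f` over the path `γ 0, …, γ n`. -/
def pathIntegral (f : LatPlus → ℂ) (n : ℕ) (γ : ℕ → LatPlus) : ℂ :=
  ∑ k ∈ Finset.range n,
    (f (γ k) + f (γ (k + 1))) / 2 * ((γ (k + 1)).toC - (γ k).toC)

/-- The standard path from `0` to `z = x + iy` in `Λ₊`: first `|y|` vertical steps along the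
imaginary axis, then `x` horizontal steps. -/
def stdPath (z : LatPlus) (k : ℕ) : LatPlus :=
  ⟨⟨((k - z.im.natAbs : ℕ) : ℤ), z.im.sign * ((min k z.im.natAbs : ℕ) : ℤ)⟩,
    Int.natCast_nonneg _⟩

/-- The number of steps of the standard path. -/
def stdLength (z : LatPlus) : ℕ := z.im.natAbs + z.re.toNat

/-- `∫₀ᶻ f δz`, computed along the standard path. For discrete analytic `f` the value is the same
along every path in `Λ₊` from `0` to `z`; see `pathIntegral_eq_integralTo`. -/
def integralTo (f : LatPlus → ℂ) (z : LatPlus) : ℂ :=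
  pathIntegral f (stdLength z) (stdPath z)

/-- The operator `Zf(z) = (f(0) - f(z)) / 2 + ∫₀ᶻ f δz`. -/
def opZ (f : LatPlus → ℂ) : LatPlus → ℂ :=
  fun z => (f origin - f z) / 2 + integralTo f z

/-- The difference operator `δₓf(z) = f(z+1) - f(z)`. -/
def deltaX (f : LatPlus → ℂ) : LatPlus → ℂ :=
  fun z => f z.east - f z

/-- The discrete powers `z⁽ⁿ⁾ = (Zⁿ1)(z)`. -/
def zpoly (n : ℕ) : LatPlus → ℂ := opZ^[n] (fun _ => 1)

/-- The coefficients `f̂(n) = (δₓⁿf)(0)` of `f` in the basis `z⁽ⁿ⁾`. -/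
def coeff (f : LatPlus → ℂ) (n : ℕ) : ℂ := (deltaX^[n] f) origin

/-- The convolution product `(s ⊙ f)(z) = ∑ₙ ∑_{m ≤ n} ŝ(m) f̂(n-m) z⁽ⁿ⁾`. -/
def conv (s f : LatPlus → ℂ) : LatPlus → ℂ :=
  fun z => ∑' n : ℕ,
    (∑ m ∈ Finset.range (n + 1), coeff s m * coeff f (n - m)) * zpoly n z

/-- The convolution powers `f^{⊙k}`, with `f^{⊙0} = 1`. -/
def convPow (f : LatPlus → ℂ) : ℕ → LatPlus → ℂ
  | 0 => fun _ => 1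
  | k + 1 => conv f (convPow f k)

/-! ### The Hardy space and the Schur class -/

/-- Membership in the Hardy space `H₂(Λ₊)`: discrete analytic functions
`f(z) = ∑ₙ f̂(n) z⁽ⁿ⁾` with `∑ₙ |f̂(n)|² < ∞`. -/
structure MemH2 (f : LatPlus → ℂ) : Prop where
  analytic : IsDiscreteAnalytic f
  summable_sq : Summable fun n => ‖coeff f n‖ ^ 2
  expansion : ∀ z, HasSum (fun n => coeff f n * zpoly n z) (f z)

/-- The Hardy space `H₂(Λ₊)` as a set of functions on `Λ₊`. -/
def H2 : Set (LatPlus → ℂ) := {f | MemH2 f}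

/-- The inner product `⟨f, g⟩ = ∑ₙ f̂(n) ĝ(n)^*` of `H₂(Λ₊)`. -/
def h2Inner (f g : LatPlus → ℂ) : ℂ := ∑' n : ℕ, coeff f n * star (coeff g n)

/-- The norm of `H₂(Λ₊)`. -/
def h2Norm (f : LatPlus → ℂ) : ℝ := √(h2Inner f f).re

/-- The kernel `K^s_w(z) = ∑ₙ (z⁽ⁿ⁾ w⁽ⁿ⁾^* - (Zⁿs)(z) (Zⁿs)(w)^*)`, with rows indexed by `z` and
columns indexed by `w`. -/
def schurKernel (s : LatPlus → ℂ) : Matrix LatPlus LatPlus ℂ :=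
  fun z w => ∑' n : ℕ,
    (zpoly n z * star (zpoly n w) - (opZ^[n] s) z * star ((opZ^[n] s) w))

/-- Discrete analytic Schur functions. -/
structure IsSchur (s : LatPlus → ℂ) : Prop where
  analytic : IsDiscreteAnalytic s
  summable_sq : ∀ z, Summable fun n : ℕ => ‖(opZ^[n] s) z‖ ^ 2
  positive : (schurKernel s).PosSemidef

/-- The operator `M_s f = s ⊙ f` maps `H₂(Λ₊)` isometrically into itself. -/
def IsIsometricMultiplier (s : LatPlus → ℂ) : Prop :=
  ∀ f ∈ H2, conv s f ∈ H2 ∧ h2Norm (conv s f) = h2Norm f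

/-! ### The interpolation problem and the Blaschke factors -/

/-- The rectangle
`R_lam = {z ∈ Λ₊ : Re z ≤ Re lam, |Im z| ≤ |Im lam|, Im z * Im lam ≥ 0}`. -/
def rect (lam : LatPlus) : Set LatPlus :=
  {z | z.re ≤ lam.re ∧ |z.im| ≤ |lam.im| ∧ 0 ≤ z.im * lam.im}

/-- The solutions in `H₂(Λ₊)` of the homogeneous interpolation problem `f = 0` on `R_lam`. -/
def interpolationSolutions (lam : LatPlus) : Set (LatPlus → ℂ) :=
  {f | f ∈ H2 ∧ ∀ z ∈ rect lam, f z = 0}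

/-- `B` is a function `B_lam` as in the interpolation problem for `R_lam`: a discrete analytic
Schur function for which `M_B` is isometric on `H₂(Λ₊)`, with the solutions as its range. -/
structure IsBlaschke (lam : LatPlus) (B : LatPlus → ℂ) : Prop where
  schur : IsSchur B
  isometric : IsIsometricMultiplier B
  range_eq : conv B '' H2 = interpolationSolutions lam

/-- `α₊ = (1 + i) / 2`. -/
def alphaPlus : ℂ := (1 + Complex.I) / 2

/-- `α₋ = (1 - i) / 2`. -/
def alphaMinus : ℂ := (1 - Complex.I) / 2

/-- The generating function
`G_z(t) = (1 + t)^{Re z} ((1 + α₊ t) / (1 + α₋ t))^{Im z}`. -/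
def genG (t : ℂ) (z : LatPlus) : ℂ :=
  (1 + t) ^ z.re * ((1 + alphaPlus * t) / (1 + alphaMinus * t)) ^ z.im

/-- `(1 - a z)^{-⊙} = G_z(a)`, the convolution inverse of `1 - a z`, for `|a| < 1`. -/
def convInvOneSub (a : ℂ) : LatPlus → ℂ := fun z => genG a z

/-- The function `b + a z ⊙ (1 + a z)^{-⊙} b`. -/
def blaschkeFactor (a b : ℂ) : LatPlus → ℂ :=
  fun z => b + a * conv toC (convInvOneSub (-a)) z * b

/-- The Blaschke factor of the upper quadrant,
`B₊(z) = α₋ + α₊ z ⊙ (1 + α₊ z)^{-⊙} α₋`. -/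
def blaschkePlus : LatPlus → ℂ := blaschkeFactor alphaPlus alphaMinus

/-- The Blaschke factor of the lower quadrant,
`B₋(z) = α₊ + α₋ z ⊙ (1 + α₋ z)^{-⊙} α₊`. -/
def blaschkeMinus : LatPlus → ℂ := blaschkeFactor alphaMinus alphaPlus

/-- The function `z^{(Re lam + 1)} ⊙ B_±^{⊙ |Im lam|}`, with `+` if `Im lam ≥ 0` and `-`
otherwise. -/
def explicitBlaschke (lam : LatPlus) : LatPlus → ℂ :=
  conv (zpoly (lam.re.toNat + 1))
    (convPow (if 0 ≤ lam.im then blaschkePlus else blaschkeMinus) lam.im.natAbs)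

/-! ### Path independence of the discrete integral -/

theorem stdPath_zero (z : LatPlus) : stdPath z 0 = origin := by
  simp [stdPath, origin]

theorem stdPath_stdLength (z : LatPlus) : stdPath z (stdLength z) = z := by
  obtain ⟨⟨x, y⟩, hx⟩ := z
  have hx' : 0 ≤ x := hx
  simp [stdPath, stdLength, LatPlus.re, LatPlus.im, hx', Int.sign_mul_abs]

theorem integralTo_east (f : LatPlus → ℂ) (z : LatPlus) :
    integralTo f z.east = integralTo f z + (f z + f z.east) / 2 := by
  have h1 : stdLength z.east = stdLength z + 1 := by
    obtain ⟨⟨x, y⟩, hx⟩ := z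
    have hx' : 0 ≤ x := hx
    simp only [stdLength, LatPlus.re, LatPlus.im, LatPlus.east]
    omega
  have h2 : stdPath z.east = stdPath z := rfl
  have h3 : stdPath z (stdLength z + 1) = z.east := by
    rw [← h1, ← h2, stdPath_stdLength]
  have h4 : z.east.toC - z.toC = 1 := by
    simp [LatPlus.toC, LatPlus.east, GaussianInt.toComplex_def]
  unfold integralTo
  rw [h1, h2]
  unfold pathIntegral
  rw [Finset.sum_range_succ, h3, stdPath_stdLength, h4, mul_one]

/-- The vertical step identity on the imaginary axis. -/
theorem integralTo_north_axis (f : LatPlus → ℂ) (y : ℤ) :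
    integralTo f ⟨⟨0, y + 1⟩, le_refl 0⟩ = integralTo f ⟨⟨0, y⟩, le_refl 0⟩ +
      Complex.I * (f ⟨⟨0, y⟩, le_refl 0⟩ + f ⟨⟨0, y + 1⟩, le_refl 0⟩) / 2 := by
  have key : ∀ (u v : LatPlus), stdLength v = stdLength u + 1 →
      (∀ k ≤ stdLength u, stdPath v k = stdPath u k) →
      integralTo f v = integralTo f u + (f u + f v) / 2 * (v.toC - u.toC) := by
    intro u v hl hp
    unfold integralTo
    rw [hl]
    unfold pathIntegral
    have hv : stdPath v (stdLength u + 1) = v := by rw [← hl, stdPath_stdLength]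
    have hu : stdPath v (stdLength u) = u := by rw [hp _ le_rfl, stdPath_stdLength]
    rw [Finset.sum_range_succ, hv, hu]
    congr 1
    refine Finset.sum_congr rfl fun k hk => ?_
    have hk' := Finset.mem_range.mp hk
    rw [hp k hk'.le, hp (k + 1) hk']
  have hpath : ∀ a b : ℤ, b.natAbs = a.natAbs + 1 → (a = 0 ∨ a.sign = b.sign) →
      ∀ k ≤ stdLength ⟨⟨0, a⟩, le_refl 0⟩,
        stdPath ⟨⟨0, b⟩, le_refl 0⟩ k = stdPath ⟨⟨0, a⟩, le_refl 0⟩ k := by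
    intro a b hab hs k hk
    have hk' : k ≤ a.natAbs := by simpa [stdLength, LatPlus.im, LatPlus.re] using hk
    have e1 : k - b.natAbs = 0 := by omega
    have e2 : k - a.natAbs = 0 := by omega
    have e3 : min k b.natAbs = k := by omega
    have e4 : min k a.natAbs = k := by omega
    have e5 : b.sign * ((min k b.natAbs : ℕ) : ℤ) = a.sign * ((min k a.natAbs : ℕ) : ℤ) := by
      rw [e3, e4]
      rcases hs with rfl | hs
      · have : k = 0 := by simpa using hk'
        subst this
        simp
      · rw [hs]
    exact Subtype.ext (Zsqrtd.ext (by change ((k - b.natAbs : ℕ) : ℤ) = _; rw [e1, ← e2]; rfl) e5)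
  by_cases hy : 0 ≤ y
  · rw [key ⟨⟨0, y⟩, le_refl 0⟩ ⟨⟨0, y + 1⟩, le_refl 0⟩
      (by simp only [stdLength, LatPlus.im, LatPlus.re]; omega)
      (hpath y (y + 1) (by omega) (by
        rcases hy.eq_or_lt with h | h
        · exact Or.inl h.symm
        · right; rw [Int.sign_eq_one_of_pos h, Int.sign_eq_one_of_pos (by omega)]))]
    simp only [LatPlus.toC, GaussianInt.toComplex_def]
    push_cast
    ring
  · rw [key ⟨⟨0, y + 1⟩, le_refl 0⟩ ⟨⟨0, y⟩, le_refl 0⟩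
      (by simp only [stdLength, LatPlus.im, LatPlus.re]; omega)
      (hpath (y + 1) y (by omega) (by
        rcases (show y + 1 ≤ 0 by omega).eq_or_lt with h | h
        · exact Or.inl h
        · right; rw [Int.sign_eq_neg_one_of_neg h, Int.sign_eq_neg_one_of_neg (by omega)]))]
    simp only [LatPlus.toC, GaussianInt.toComplex_def]
    push_cast
    ring

theorem integralTo_north (f : LatPlus → ℂ) (hf : IsDiscreteAnalytic f) (z : LatPlus) :
    integralTo f z.north = integralTo f z + Complex.I * (f z + f z.north) / 2 := by
  obtain ⟨⟨x, y⟩, hx⟩ := z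
  have hx' : 0 ≤ x := hx
  obtain ⟨n, rfl⟩ := Int.eq_ofNat_of_zero_le hx'
  clear hx'
  induction n with
  | zero => exact integralTo_north_axis f y
  | succ n ih =>
    have ih := ih (Int.natCast_nonneg n)
    set w : LatPlus := ⟨⟨(n : ℤ), y⟩, Int.natCast_nonneg n⟩ with hw
    have hz : (⟨⟨((n + 1 : ℕ) : ℤ), y⟩, hx⟩ : LatPlus) = w.east := by
      simp [hw, LatPlus.east]
    rw [hz]
    have hc : w.east.north = w.north.east := rfl
    have h := hf w
    have hp : (1 + Complex.I) ≠ 0 := by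
      intro h0; simpa using congrArg Complex.re h0
    have hm : (1 - Complex.I) ≠ 0 := by
      intro h0; simpa using congrArg Complex.re h0
    rw [div_eq_div_iff hp hm, hc] at h
    rw [hc, integralTo_east, integralTo_east, ih]
    linear_combination h / 2

theorem integralTo_step (f : LatPlus → ℂ) (hf : IsDiscreteAnalytic f) (u v : LatPlus)
    (h : ‖v.toC - u.toC‖ = 1) :
    integralTo f v = integralTo f u + (f u + f v) / 2 * (v.toC - u.toC) := by
  obtain ⟨⟨a, b⟩, hu⟩ := u
  obtain ⟨⟨c, d⟩, hv⟩ := v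
  have hsq : (c - a) ^ 2 + (d - b) ^ 2 = 1 := by
    have h2 : Complex.normSq (LatPlus.toC ⟨⟨c, d⟩, hv⟩ - LatPlus.toC ⟨⟨a, b⟩, hu⟩) = 1 := by
      rw [Complex.normSq_eq_norm_sq, h, one_pow]
    simp only [LatPlus.toC, GaussianInt.toComplex_def₂, Complex.normSq_apply, Complex.sub_re,
      Complex.sub_im] at h2
    have h3 : (((c - a) ^ 2 + (d - b) ^ 2 : ℤ) : ℝ) = ((1 : ℤ) : ℝ) := by
      push_cast
      linear_combination h2
    exact_mod_cast h3
  have hcase : (c = a + 1 ∧ d = b) ∨ (a = c + 1 ∧ d = b) ∨ (c = a ∧ d = b + 1) ∨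
      (c = a ∧ b = d + 1) := by
    have h1 : -1 ≤ c - a := by nlinarith [sq_nonneg (d - b)]
    have h2 : c - a ≤ 1 := by nlinarith [sq_nonneg (d - b)]
    have h3 : -1 ≤ d - b := by nlinarith [sq_nonneg (c - a)]
    have h4 : d - b ≤ 1 := by nlinarith [sq_nonneg (c - a)]
    generalize hp : c - a = p at *
    generalize hq : d - b = q at *
    interval_cases p <;> interval_cases q <;> omega
  rcases hcase with ⟨rfl, rfl⟩ | ⟨rfl, rfl⟩ | ⟨rfl, rfl⟩ | ⟨rfl, rfl⟩
  · have e := integralTo_east f ⟨⟨a, d⟩, hu⟩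
    simp only [LatPlus.east] at e
    rw [e]
    simp only [LatPlus.toC, GaussianInt.toComplex_def]
    push_cast
    ring
  · have e := integralTo_east f ⟨⟨c, d⟩, hv⟩
    simp only [LatPlus.east] at e
    rw [e]
    simp only [LatPlus.toC, GaussianInt.toComplex_def]
    push_cast
    ring
  · have e := integralTo_north f hf ⟨⟨c, b⟩, hu⟩
    simp only [LatPlus.north] at e
    rw [e]
    simp only [LatPlus.toC, GaussianInt.toComplex_def]
    push_cast
    ring
  · have e := integralTo_north f hf ⟨⟨c, d⟩, hv⟩
    simp only [LatPlus.north] at e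
    rw [e]
    simp only [LatPlus.toC, GaussianInt.toComplex_def]
    push_cast
    ring

/-- For discrete analytic `f` the integral along any path in `Λ₊` from `0` to `z` is
`integralTo f z`. -/
theorem pathIntegral_eq_integralTo (f : LatPlus → ℂ) (hf : IsDiscreteAnalytic f) (z : LatPlus)
    (n : ℕ) (γ : ℕ → LatPlus) (hγ : IsPath n γ) (h0 : γ 0 = origin) (hn : γ n = z) :
    pathIntegral f n γ = integralTo f z := by
  subst hn
  induction n with
  | zero => rw [h0]; simp [pathIntegral, integralTo, stdLength, origin, LatPlus.im, LatPlus.re]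
  | succ n ih =>
    rw [integralTo_step f hf (γ n) (γ (n + 1)) (hγ n n.lt_succ_self),
      ← ih fun k hk => hγ k (hk.trans n.lt_succ_self)]
    simp only [pathIntegral, Finset.sum_range_succ]

end DiscreteAnalytic

end

open DiscreteAnalytic

noncomputable section

namespace DiscreteAnalytic

open PowerSeries (X C)
open scoped PowerSeries ComplexConjugate
open LatPlus

/-! ### Square-summable power series -/

/-! Everything is transported to power series. A function in the Hardy space is its coefficient
series `φ`, square summable. Convolution becomes multiplication, the operator `Z` becomes
multiplication by `X`, and evaluation at `z` becomes the bilinear pairing with the generating series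
`G_z = ∑ z⁽ⁿ⁾ tⁿ`. These satisfy `G_{z+1} = (1 + t) G_z` and `(1 + α₋t) G_{z+i} = (1 + α₊t) G_z`, so
they are square summable (`sqSummable_genSeries`), and vertical steps of functions obey a two-term
rule (`expand_X_mul_north`).

With `β = α₊` or `α₋`, so `|β|² = 1/2`, the Blaschke factor has series `b = (β̄ + X)/(1 + βX)`, the
classical factor with zero `-β̄` in the unit disc. Multiplication by it is isometric by a
telescoping identity (`sqNorm_conj_add_X_mul`).

Vanishing at `0, …, p` on the real axis means divisibility by `X^(p+1)`. Each further row of zeros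
costs exactly one factor `b`: if `φ = (β̄ + X) g`, the difference of `φ` across a vertical edge is
`(β - β̄)` times the value of `g` at the edge's first point, so zeros of `φ` on two adjacent rows
give zeros of `g` on the first (`exists_eq_mul_of_vanishesOnGrid_succ`, `VanishesOnGrid.mul`). Hence
the solutions of the interpolation problem are the multiples of `X^(p+1) b^q`.

An isometric multiplier is a Schur function because `∑ (Zⁿs)(z) tⁿ` is the image of `G_z` under the
transposed multiplication, a contraction (`isSchur_expand`). For uniqueness, two isometric
multipliers with the same range divide each other, and comparing norms with constant terms leaves
only a unimodular constant (`eq_C_mul_of_mul_eq`). The isometry and range conditions see only the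
coefficients of `B`, hence only its values on the real axis; positivity of the Schur kernel forces
`B` to be the sum of its expansion everywhere (`IsSchur.hasSum_nat`). -/

/-- The coefficients of `φ` are square summable. -/
def SqSummable (φ : ℂ⟦X⟧) : Prop := Summable fun n => ‖PowerSeries.coeff n φ‖ ^ 2

/-- The sum of the squared absolute values of the coefficients. -/
def sqNorm (φ : ℂ⟦X⟧) : ℝ := ∑' n, ‖PowerSeries.coeff n φ‖ ^ 2

/-- The bilinear pairing `∑ₙ φₙ uₙ`. -/
def pairing (φ u : ℂ⟦X⟧) : ℂ := ∑' n, PowerSeries.coeff n φ * PowerSeries.coeff n u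

theorem sq_norm_add_le (a b : ℂ) : ‖a + b‖ ^ 2 ≤ 2 * ‖a‖ ^ 2 + 2 * ‖b‖ ^ 2 := by
  have h := norm_add_le a b
  nlinarith [norm_nonneg (a + b), sq_nonneg (‖a‖ - ‖b‖)]

/-- The weights come from `(x + y)² ≤ 3x² + (3/2)y²`. What matters is that `3/4 < 1`: in a
first-order recursion the second term can be absorbed into the left side. -/
theorem sq_norm_sub_le_of_sq_eq_half (a b β : ℂ) (hβ : ‖β‖ ^ 2 = 1 / 2) :
    ‖a - β * b‖ ^ 2 ≤ 3 * ‖a‖ ^ 2 + 3 / 4 * ‖b‖ ^ 2 := by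
  have h := norm_sub_le a (β * b)
  have hb : ‖β * b‖ ^ 2 = 1 / 2 * ‖b‖ ^ 2 := by rw [norm_mul, mul_pow, hβ]
  nlinarith [norm_nonneg (a - β * b), sq_nonneg (2 * ‖a‖ - ‖β * b‖), norm_nonneg a,
    norm_nonneg (β * b)]

theorem SqSummable.add {φ ψ : ℂ⟦X⟧} (hφ : SqSummable φ) (hψ : SqSummable ψ) :
    SqSummable (φ + ψ) := by
  refine Summable.of_nonneg_of_le (fun n => by positivity) (fun n => ?_)
    ((hφ.mul_left 2).add (hψ.mul_left 2))
  rw [map_add]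
  exact sq_norm_add_le _ _

theorem SqSummable.C_mul {φ : ℂ⟦X⟧} (hφ : SqSummable φ) (c : ℂ) : SqSummable (C c * φ) := by
  unfold SqSummable
  simp only [PowerSeries.coeff_C_mul, norm_mul, mul_pow]
  exact hφ.mul_left _

theorem SqSummable.X_mul {φ : ℂ⟦X⟧} (hφ : SqSummable φ) : SqSummable (X * φ) := by
  unfold SqSummable
  rw [← summable_nat_add_iff 1]
  simp only [PowerSeries.coeff_succ_X_mul]
  exact hφ

theorem SqSummable.of_X_mul {φ : ℂ⟦X⟧} (hφ : SqSummable (X * φ)) : SqSummable φ := by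
  unfold SqSummable at hφ
  rw [← summable_nat_add_iff 1] at hφ
  simp only [PowerSeries.coeff_succ_X_mul] at hφ
  exact hφ

theorem SqSummable.X_pow_mul {φ : ℂ⟦X⟧} (hφ : SqSummable φ) (n : ℕ) :
    SqSummable (X ^ n * φ) := by
  induction n with
  | zero => simpa using hφ
  | succ n ih => rw [pow_succ', mul_assoc]; exact ih.X_mul

theorem SqSummable.of_X_pow_mul {φ : ℂ⟦X⟧} {n : ℕ} (hφ : SqSummable (X ^ n * φ)) :
    SqSummable φ := by
  induction n with
  | zero => simpa using hφ
  | succ n ih => rw [pow_succ', mul_assoc] at hφ; exact ih hφ.of_X_mul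

theorem SqSummable.sum {ι : Type*} (s : Finset ι) (φ : ι → ℂ⟦X⟧) (h : ∀ i, SqSummable (φ i)) :
    SqSummable (∑ i ∈ s, φ i) := by
  classical
  induction s using Finset.induction_on with
  | empty => simp [SqSummable]
  | insert a s ha ih => rw [Finset.sum_insert ha]; exact (h a).add ih

theorem hasSum_C_sq (c : ℂ) :
    HasSum (fun n => ‖PowerSeries.coeff n (C c : ℂ⟦X⟧)‖ ^ 2) (‖c‖ ^ 2) := by
  convert! hasSum_single (f := fun n => ‖PowerSeries.coeff n (C c : ℂ⟦X⟧)‖ ^ 2) 0 ?_ using 1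
  · simp
  · intro n hn
    simp [PowerSeries.coeff_C, hn]

theorem sqSummable_C (c : ℂ) : SqSummable (C c) := (hasSum_C_sq c).summable

theorem sqNorm_C (c : ℂ) : sqNorm (C c) = ‖c‖ ^ 2 := (hasSum_C_sq c).tsum_eq

theorem sqSummable_one : SqSummable 1 := by simpa using sqSummable_C 1

theorem sqNorm_one : sqNorm 1 = 1 := by simpa using sqNorm_C 1

theorem sqNorm_X_mul {φ : ℂ⟦X⟧} (hφ : SqSummable φ) : sqNorm (X * φ) = sqNorm φ := by
  unfold sqNorm
  rw [Summable.tsum_eq_zero_add hφ.X_mul]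
  simp [PowerSeries.coeff_succ_X_mul]

theorem sqNorm_C_mul (c : ℂ) (φ : ℂ⟦X⟧) : sqNorm (C c * φ) = ‖c‖ ^ 2 * sqNorm φ := by
  unfold sqNorm
  simp only [PowerSeries.coeff_C_mul, norm_mul, mul_pow]
  exact tsum_mul_left

theorem norm_mul_le_half_sq (a b : ℂ) : ‖a * b‖ ≤ 1 / 2 * ‖a‖ ^ 2 + 1 / 2 * ‖b‖ ^ 2 := by
  rw [norm_mul]
  nlinarith [sq_nonneg (‖a‖ - ‖b‖)]

theorem SqSummable.summable_norm_mul {φ u : ℂ⟦X⟧} (hφ : SqSummable φ) (hu : SqSummable u) :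
    Summable fun n => ‖PowerSeries.coeff n φ * PowerSeries.coeff n u‖ :=
  Summable.of_nonneg_of_le (fun _ => norm_nonneg _) (fun _ => norm_mul_le_half_sq _ _)
    ((hφ.mul_left (1 / 2)).add (hu.mul_left (1 / 2)))

theorem SqSummable.summable_mul {φ u : ℂ⟦X⟧} (hφ : SqSummable φ) (hu : SqSummable u) :
    Summable fun n => PowerSeries.coeff n φ * PowerSeries.coeff n u :=
  (hφ.summable_norm_mul hu).of_norm

theorem norm_pairing_le {φ u : ℂ⟦X⟧} (hφ : SqSummable φ) (hu : SqSummable u) :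
    ‖pairing φ u‖ ≤ 1 / 2 * sqNorm φ + 1 / 2 * sqNorm u := by
  refine (norm_tsum_le_tsum_norm (hφ.summable_norm_mul hu)).trans ?_
  unfold sqNorm
  rw [← tsum_mul_left, ← tsum_mul_left,
    ← Summable.tsum_add (hφ.mul_left (1 / 2)) (hu.mul_left (1 / 2))]
  exact Summable.tsum_le_tsum (fun _ => norm_mul_le_half_sq _ _) (hφ.summable_norm_mul hu)
    ((hφ.mul_left (1 / 2)).add (hu.mul_left (1 / 2)))

theorem pairing_comm (φ u : ℂ⟦X⟧) : pairing φ u = pairing u φ := by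
  simp only [pairing, mul_comm]

theorem pairing_add_left {φ ψ u : ℂ⟦X⟧} (hφ : SqSummable φ) (hψ : SqSummable ψ)
    (hu : SqSummable u) : pairing (φ + ψ) u = pairing φ u + pairing ψ u := by
  unfold pairing
  rw [← Summable.tsum_add (hφ.summable_mul hu) (hψ.summable_mul hu)]
  simp only [map_add, add_mul]

theorem pairing_add_right {φ u v : ℂ⟦X⟧} (hφ : SqSummable φ) (hu : SqSummable u)
    (hv : SqSummable v) : pairing φ (u + v) = pairing φ u + pairing φ v := by
  rw [pairing_comm, pairing_add_left hu hv hφ, pairing_comm u, pairing_comm v]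

theorem pairing_C_mul_left (c : ℂ) (φ u : ℂ⟦X⟧) : pairing (C c * φ) u = c * pairing φ u := by
  unfold pairing
  simp only [PowerSeries.coeff_C_mul, mul_assoc]
  exact tsum_mul_left

theorem pairing_C_mul_right (c : ℂ) (φ u : ℂ⟦X⟧) : pairing φ (C c * u) = c * pairing φ u := by
  rw [pairing_comm, pairing_C_mul_left, pairing_comm]

theorem pairing_X_mul_X_mul {φ u : ℂ⟦X⟧} (hφ : SqSummable φ) (hu : SqSummable u) :
    pairing (X * φ) (X * u) = pairing φ u := by
  unfold pairing
  rw [Summable.tsum_eq_zero_add (hφ.X_mul.summable_mul hu.X_mul)]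
  simp [PowerSeries.coeff_succ_X_mul]

theorem pairing_one_right (φ : ℂ⟦X⟧) : pairing φ 1 = PowerSeries.coeff 0 φ := by
  unfold pairing
  rw [tsum_eq_single 0]
  · simp
  · intro n hn
    simp [PowerSeries.coeff_one, hn]

theorem pairing_sum_left {ι : Type*} (s : Finset ι) (φ : ι → ℂ⟦X⟧) {u : ℂ⟦X⟧}
    (h : ∀ i, SqSummable (φ i)) (hu : SqSummable u) :
    pairing (∑ i ∈ s, φ i) u = ∑ i ∈ s, pairing (φ i) u := by
  classical
  induction s using Finset.induction_on with
  | empty => simp [pairing]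
  | insert a s ha ih =>
    rw [Finset.sum_insert ha, Finset.sum_insert ha,
      pairing_add_left (h a) (SqSummable.sum s φ h) hu, ih]

theorem pairing_sum_right {ι : Type*} (s : Finset ι) {φ : ℂ⟦X⟧} (u : ι → ℂ⟦X⟧)
    (hφ : SqSummable φ) (h : ∀ i, SqSummable (u i)) :
    pairing φ (∑ i ∈ s, u i) = ∑ i ∈ s, pairing φ (u i) := by
  rw [pairing_comm, pairing_sum_left s u h hφ]
  exact Finset.sum_congr rfl fun i _ => pairing_comm _ _

/-! ### Division by linear factors -/

theorem coeff_succ_one_add_C_mul_X_mul (β : ℂ) (g : ℂ⟦X⟧) (n : ℕ) :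
    PowerSeries.coeff (n + 1) ((1 + C β * X) * g) =
      PowerSeries.coeff (n + 1) g + β * PowerSeries.coeff n g := by
  rw [add_mul, one_mul, mul_assoc, map_add, PowerSeries.coeff_C_mul, PowerSeries.coeff_succ_X_mul]

theorem coeff_zero_one_add_C_mul_X_mul (β : ℂ) (g : ℂ⟦X⟧) :
    PowerSeries.coeff 0 ((1 + C β * X) * g) = PowerSeries.coeff 0 g := by
  rw [add_mul, one_mul, mul_assoc, map_add, PowerSeries.coeff_C_mul, PowerSeries.coeff_zero_X_mul,
    mul_zero, add_zero]

theorem coeff_succ_C_add_X_mul (β : ℂ) (g : ℂ⟦X⟧) (n : ℕ) :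
    PowerSeries.coeff (n + 1) ((C β + X) * g) =
      β * PowerSeries.coeff (n + 1) g + PowerSeries.coeff n g := by
  rw [add_mul, map_add, PowerSeries.coeff_C_mul, PowerSeries.coeff_succ_X_mul]

theorem coeff_zero_C_add_X_mul (β : ℂ) (g : ℂ⟦X⟧) :
    PowerSeries.coeff 0 ((C β + X) * g) = β * PowerSeries.coeff 0 g := by
  rw [add_mul, map_add, PowerSeries.coeff_C_mul, PowerSeries.coeff_zero_X_mul, add_zero]

theorem SqSummable.one_add_mul {g : ℂ⟦X⟧} (hg : SqSummable g) (β : ℂ) :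
    SqSummable ((1 + C β * X) * g) := by
  rw [add_mul, one_mul, mul_assoc]
  exact hg.add (hg.X_mul.C_mul β)

theorem SqSummable.C_add_X_mul {g : ℂ⟦X⟧} (hg : SqSummable g) (β : ℂ) :
    SqSummable ((C β + X) * g) := by
  rw [add_mul]
  exact (hg.C_mul β).add hg.X_mul

/-- The root of `1 + βX` lies outside the closed unit disc, so the forward recursion `gₙ₊₁ = φₙ₊₁ -
β gₙ` is stable. -/
theorem SqSummable.of_one_add_mul {g : ℂ⟦X⟧} {β : ℂ} (hβ : ‖β‖ ^ 2 = 1 / 2)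
    (hφ : SqSummable ((1 + C β * X) * g)) : SqSummable g := by
  set φ := (1 + C β * X) * g with hdef
  have hs : ∀ n, PowerSeries.coeff (n + 1) g =
      PowerSeries.coeff (n + 1) φ - β * PowerSeries.coeff n g := fun n => by
    rw [hdef, coeff_succ_one_add_C_mul_X_mul]; ring
  have hz : PowerSeries.coeff 0 g = PowerSeries.coeff 0 φ := by
    rw [hdef, coeff_zero_one_add_C_mul_X_mul]
  have key : ∀ N, ∑ n ∈ Finset.range (N + 1), ‖PowerSeries.coeff n g‖ ^ 2 ≤
      3 * ∑ n ∈ Finset.range (N + 1), ‖PowerSeries.coeff n φ‖ ^ 2 +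
      3 / 4 * ∑ n ∈ Finset.range N, ‖PowerSeries.coeff n g‖ ^ 2 := by
    intro N
    rw [Finset.sum_range_succ', Finset.sum_range_succ' (fun n => ‖PowerSeries.coeff n φ‖ ^ 2), hz,
      mul_add, Finset.mul_sum, Finset.mul_sum]
    have := Finset.sum_le_sum fun n (_ : n ∈ Finset.range N) =>
      sq_norm_sub_le_of_sq_eq_half (PowerSeries.coeff (n + 1) φ) (PowerSeries.coeff n g) β hβ
    simp only [← hs, Finset.sum_add_distrib] at this
    nlinarith [sq_nonneg ‖PowerSeries.coeff 0 φ‖]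
  -- Absorbing the `3/4` of the recursive estimate gives `12 = 3 / (1 - 3/4)`.
  refine summable_of_sum_range_le (c := 12 * ∑' n, ‖PowerSeries.coeff n φ‖ ^ 2)
    (fun n => by positivity) fun N => ?_
  have h1 := hφ.sum_le_tsum (Finset.range (N + 1)) fun n _ => by positivity
  have h2 := key N
  rw [Finset.sum_range_succ] at h2
  nlinarith [sq_nonneg ‖PowerSeries.coeff N g‖]

/-- Here the root `-β` lies inside the disc, so a remainder `ε` is unavoidable and forward recursion
would be unstable. The quotient is found by solving backwards from infinity: `γₙ = ∑ₖ (-β)ᵏ φₙ₊₁₊ₖ`.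
-/
theorem SqSummable.exists_eq_C_add_X_mul_add_C {φ : ℂ⟦X⟧} (hφ : SqSummable φ) {β : ℂ}
    (hβ : ‖β‖ ^ 2 = 1 / 2) : ∃ g, SqSummable g ∧ ∃ ε, φ = (C β + X) * g + C ε := by
  have hβ1 : ‖β‖ < 1 := by nlinarith [norm_nonneg β]
  set S := ∑' n, ‖PowerSeries.coeff n φ‖ ^ 2 with hS
  have hS0 : 0 ≤ S := tsum_nonneg fun n => by positivity
  have hb : ∀ n, ‖PowerSeries.coeff n φ‖ ≤ 1 + S := fun n => by
    have := hφ.le_tsum n fun m _ => by positivity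
    nlinarith [sq_nonneg (‖PowerSeries.coeff n φ‖ - 1), norm_nonneg (PowerSeries.coeff n φ)]
  have hgeo : Summable fun k : ℕ => ‖β‖ ^ k * (1 + S) :=
    (summable_geometric_of_lt_one (norm_nonneg _) hβ1).mul_right _
  have hle : ∀ n k, ‖(-β) ^ k * PowerSeries.coeff (n + 1 + k) φ‖ ≤ ‖β‖ ^ k * (1 + S) := by
    intro n k
    rw [norm_mul, norm_pow, norm_neg]
    exact mul_le_mul_of_nonneg_left (hb _) (by positivity)
  have hsum : ∀ n, Summable fun k => (-β) ^ k * PowerSeries.coeff (n + 1 + k) φ := fun n =>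
    Summable.of_norm_bounded hgeo (hle n)
  set γ : ℕ → ℂ := fun n => ∑' k, (-β) ^ k * PowerSeries.coeff (n + 1 + k) φ with hγ
  have hγb : ∀ n, ‖γ n‖ ≤ ∑' k : ℕ, ‖β‖ ^ k * (1 + S) := fun n =>
    tsum_of_norm_bounded hgeo.hasSum (hle n)
  have hrec : ∀ n, γ n = PowerSeries.coeff (n + 1) φ - β * γ (n + 1) := by
    intro n
    simp only [hγ]
    rw [Summable.tsum_eq_zero_add (hsum n), ← tsum_mul_left, sub_eq_add_neg, ← tsum_neg]
    congr 1
    · simp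
    · refine tsum_congr fun k => ?_
      rw [show n + 1 + (k + 1) = n + 1 + 1 + k by ring, pow_succ]
      ring
  refine ⟨PowerSeries.mk γ, ?_, PowerSeries.coeff 0 φ - β * γ 0, ?_⟩
  -- The backward recursion bounds the sum of `|γₙ|²` over `n < N` by itself shifted by one. The
  -- boundary term `|γ_N|² ≤ M²` is the price of the shift, whence the constant `12 S + 3 M²`.
  · set M := ∑' k : ℕ, ‖β‖ ^ k * (1 + S)
    refine summable_of_sum_range_le (c := 12 * S + 3 * M ^ 2) (fun n => by positivity) fun N => ?_
    simp only [PowerSeries.coeff_mk]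
    have h1 := Finset.sum_le_sum fun n (_ : n ∈ Finset.range N) =>
      sq_norm_sub_le_of_sq_eq_half (PowerSeries.coeff (n + 1) φ) (γ (n + 1)) β hβ
    simp only [← hrec, Finset.sum_add_distrib, ← Finset.mul_sum] at h1
    have h2 := hφ.sum_le_tsum (Finset.range (N + 1)) fun n _ => by positivity
    rw [Finset.sum_range_succ'] at h2
    have h3 := Finset.sum_range_succ (fun n => ‖γ n‖ ^ 2) N
    rw [Finset.sum_range_succ'] at h3
    have h4 : ‖γ N‖ ^ 2 ≤ M ^ 2 := pow_le_pow_left₀ (norm_nonneg _) (hγb N) 2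
    nlinarith [sq_nonneg ‖γ 0‖, sq_nonneg ‖PowerSeries.coeff 0 φ‖]
  · ext n
    cases n with
    | zero => rw [map_add, coeff_zero_C_add_X_mul]; simp
    | succ n =>
      rw [map_add, coeff_succ_C_add_X_mul]
      simp only [PowerSeries.coeff_mk, PowerSeries.coeff_C, Nat.succ_ne_zero, if_false]
      rw [hrec n]
      ring

/-- The coefficient form of `|β̄ + t| = |1 + βt|` on the unit circle. The cross terms of `|β̄a +
b|²` and `|a + βb|²` agree, so the difference is `(|b|² - |a|²)/2`, which telescopes to zero over
consecutive coefficients. -/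
theorem sqNorm_conj_add_X_mul {g : ℂ⟦X⟧} (hg : SqSummable g) {β : ℂ} (hβ : ‖β‖ ^ 2 = 1 / 2) :
    sqNorm ((C (conj β) + X) * g) = sqNorm ((1 + C β * X) * g) := by
  have hterm : ∀ n, ‖PowerSeries.coeff n ((C (conj β) + X) * g)‖ ^ 2 =
      ‖PowerSeries.coeff n ((1 + C β * X) * g)‖ ^ 2 +
        (1 / 2 * ‖PowerSeries.coeff n (X * g)‖ ^ 2 - 1 / 2 * ‖PowerSeries.coeff n g‖ ^ 2) := by
    have h2 : β.re * β.re + β.im * β.im = 1 / 2 := by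
      rw [← hβ, ← Complex.normSq_eq_norm_sq, Complex.normSq_apply]
    intro n
    cases n with
    | zero =>
      rw [coeff_zero_C_add_X_mul, coeff_zero_one_add_C_mul_X_mul, PowerSeries.coeff_zero_X_mul,
        norm_mul, mul_pow, Complex.norm_conj, hβ]
      simp
      ring
    | succ n =>
      rw [coeff_succ_C_add_X_mul, coeff_succ_one_add_C_mul_X_mul, PowerSeries.coeff_succ_X_mul]
      generalize PowerSeries.coeff (n + 1) g = a
      generalize PowerSeries.coeff n g = b
      simp only [← Complex.normSq_eq_norm_sq, Complex.normSq_apply, Complex.add_re, Complex.add_im,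
        Complex.mul_re, Complex.mul_im, Complex.conj_re, Complex.conj_im]
      linear_combination (a.re ^ 2 + a.im ^ 2 - b.re ^ 2 - b.im ^ 2) * h2
  unfold sqNorm
  simp only [hterm]
  have h1 := hg.X_mul.mul_left (1 / 2)
  have h2 := hg.mul_left (1 / 2)
  rw [Summable.tsum_add (hg.one_add_mul β) (h1.sub h2), Summable.tsum_sub h1 h2, tsum_mul_left,
    tsum_mul_left, show ∑' n, ‖PowerSeries.coeff n (X * g)‖ ^ 2 = ∑' n, ‖PowerSeries.coeff n g‖ ^ 2
      from sqNorm_X_mul hg]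
  ring

theorem isUnit_one_add_C_mul_X (β : ℂ) : IsUnit (1 + C β * X : ℂ⟦X⟧) := by
  rw [PowerSeries.isUnit_iff_constantCoeff]
  simp

/-! ### Isometric multipliers -/

/-- Multiplication by `b` preserves square summability and the norm. -/
def IsometricSeries (b : ℂ⟦X⟧) : Prop :=
  ∀ f, SqSummable f → SqSummable (b * f) ∧ sqNorm (b * f) = sqNorm f

theorem IsometricSeries.mul {a b : ℂ⟦X⟧} (ha : IsometricSeries a) (hb : IsometricSeries b) :
    IsometricSeries (a * b) := fun f hf => by
  rw [mul_assoc]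
  exact ⟨(ha _ (hb f hf).1).1, (ha _ (hb f hf).1).2.trans (hb f hf).2⟩

theorem isometricSeries_one : IsometricSeries 1 := fun f hf => by simpa using hf

theorem IsometricSeries.pow {a : ℂ⟦X⟧} (ha : IsometricSeries a) (n : ℕ) :
    IsometricSeries (a ^ n) := by
  induction n with
  | zero => simpa using isometricSeries_one
  | succ n ih => rw [pow_succ]; exact ih.mul ha

theorem isometricSeries_X : IsometricSeries X := fun _ hf => ⟨hf.X_mul, sqNorm_X_mul hf⟩

theorem isometricSeries_C {c : ℂ} (hc : ‖c‖ = 1) : IsometricSeries (C c) := fun f hf =>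
  ⟨hf.C_mul c, by rw [sqNorm_C_mul, hc, one_pow, one_mul]⟩

theorem isometricSeries_of_one_add_mul {b : ℂ⟦X⟧} {β : ℂ} (hβ : ‖β‖ ^ 2 = 1 / 2)
    (hb : (1 + C β * X) * b = C (conj β) + X) : IsometricSeries b := fun f hf => by
  obtain ⟨g, rfl⟩ : ∃ g, f = (1 + C β * X) * g := by
    obtain ⟨u, hu⟩ := isUnit_one_add_C_mul_X β
    exact ⟨↑u⁻¹ * f, by rw [← hu, Units.mul_inv_cancel_left]⟩
  have hg := hf.of_one_add_mul hβ
  have : b * ((1 + C β * X) * g) = (C (conj β) + X) * g := by rw [← hb]; ring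
  rw [this]
  exact ⟨hg.C_add_X_mul _, sqNorm_conj_add_X_mul hg hβ⟩

theorem IsometricSeries.sqSummable {b : ℂ⟦X⟧} (hb : IsometricSeries b) : SqSummable b := by
  simpa using (hb 1 sqSummable_one).1

theorem IsometricSeries.sqNorm_eq_one {b : ℂ⟦X⟧} (hb : IsometricSeries b) : sqNorm b = 1 := by
  simpa [sqNorm_one] using (hb 1 sqSummable_one).2

/-- The adjoint of multiplication by an isometric multiplier is a contraction. -/
theorem IsometricSeries.sum_sq_pairing_le {b u : ℂ⟦X⟧} (hb : IsometricSeries b)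
    (hu : SqSummable u) (N : ℕ) :
    ∑ n ∈ Finset.range N, ‖pairing (X ^ n * b) u‖ ^ 2 ≤ sqNorm u := by
  set v : ℕ → ℂ := fun n => pairing (X ^ n * b) u with hv
  -- Testing against this `f` makes the pairing of `b f` with `u` equal to `A = ∑ |vₙ|²`, which is
  -- also the squared norm of `b f`. Then `A ≤ A/2 + ‖u‖²/2` gives the claim.
  set f : ℂ⟦X⟧ := ∑ n ∈ Finset.range N, C (conj (v n)) * X ^ n with hf
  have hXn : ∀ n, SqSummable (C (conj (v n)) * X ^ n) := fun n => by
    have := (sqSummable_one.X_pow_mul n).C_mul (conj (v n))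
    rwa [mul_one] at this
  have hfs : SqSummable f := SqSummable.sum _ _ hXn
  have hfc : ∀ n, PowerSeries.coeff n f = if n ∈ Finset.range N then conj (v n) else 0 := by
    intro n
    rw [hf, map_sum]
    simp only [PowerSeries.coeff_C_mul_X_pow, Finset.sum_ite_eq]
  have hfn : sqNorm f = ∑ n ∈ Finset.range N, ‖v n‖ ^ 2 := by
    unfold sqNorm
    rw [tsum_eq_sum (s := Finset.range N)]
    · refine Finset.sum_congr rfl fun n hn => ?_
      rw [hfc, if_pos hn, Complex.norm_conj]
    · intro n hn
      rw [hfc, if_neg hn]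
      simp
  have hp : pairing (b * f) u = ((∑ n ∈ Finset.range N, ‖v n‖ ^ 2 : ℝ) : ℂ) := by
    have : b * f = ∑ n ∈ Finset.range N, C (conj (v n)) * (X ^ n * b) := by
      rw [hf, Finset.mul_sum]
      exact Finset.sum_congr rfl fun n _ => by ring
    rw [this, pairing_sum_left _ _ (fun n => (hb.sqSummable.X_pow_mul n).C_mul _) hu]
    push_cast
    refine Finset.sum_congr rfl fun n _ => ?_
    rw [pairing_C_mul_left, Complex.conj_mul']
  have h := norm_pairing_le (hb f hfs).1 hu
  rw [hp, (hb f hfs).2, hfn, Complex.norm_real, Real.norm_of_nonneg (by positivity)] at h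
  linarith

/-- Two isometric multipliers that divide each other differ by a unimodular constant. -/
theorem eq_C_mul_of_mul_eq {a b h k : ℂ⟦X⟧} (ha : IsometricSeries a) (hb : IsometricSeries b)
    (hh : SqSummable h) (hk : SqSummable k) (h1 : b = a * h) (h2 : a = b * k) :
    ∃ c : ℂ, ‖c‖ = 1 ∧ b = C c * a := by
  have hnh : sqNorm h = 1 := by rw [← (ha h hh).2, ← h1, hb.sqNorm_eq_one]
  have hnk : sqNorm k = 1 := by rw [← (hb k hk).2, ← h2, ha.sqNorm_eq_one]
  have ha0 : a ≠ 0 := by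
    rintro rfl
    have := ha.sqNorm_eq_one
    simp [sqNorm] at this
  have hhk : h * k = 1 := by
    refine mul_left_cancel₀ ha0 ?_
    rw [← mul_assoc, ← h1, ← h2, mul_one]
  have h0 : ‖PowerSeries.coeff 0 h‖ * ‖PowerSeries.coeff 0 k‖ = 1 := by
    rw [← norm_mul, PowerSeries.coeff_zero_eq_constantCoeff, ← map_mul, hhk, map_one, norm_one]
  have le_one : ∀ φ : ℂ⟦X⟧, SqSummable φ → sqNorm φ = 1 → ‖PowerSeries.coeff 0 φ‖ ≤ 1 := by
    intro φ hφ hn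
    have := hφ.le_tsum 0 fun m _ => by positivity
    rw [show ∑' n, ‖PowerSeries.coeff n φ‖ ^ 2 = 1 from hn] at this
    exact (sq_le_one_iff₀ (norm_nonneg _)).1 this
  -- Two numbers at most `1` with product `1`. The constant term of `h` then exhausts its norm, so
  -- all other coefficients vanish.
  have h3 : ‖PowerSeries.coeff 0 h‖ = 1 := by
    have := le_one h hh hnh
    have := le_one k hk hnk
    nlinarith [norm_nonneg (PowerSeries.coeff 0 h), norm_nonneg (PowerSeries.coeff 0 k)]
  refine ⟨PowerSeries.coeff 0 h, h3, ?_⟩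
  suffices h = C (PowerSeries.coeff 0 h) by rw [← this, h1, mul_comm]
  ext n
  rcases Nat.eq_zero_or_pos n with rfl | hn
  · simp
  · rw [PowerSeries.coeff_C, if_neg hn.ne']
    have := hh.sum_le_tsum {0, n} fun m _ => by positivity
    rw [show ∑' n, ‖PowerSeries.coeff n h‖ ^ 2 = 1 from hnh, Finset.sum_pair hn.ne, h3] at this
    have h4 : ‖PowerSeries.coeff n h‖ ^ 2 = 0 := by
      nlinarith [sq_nonneg ‖PowerSeries.coeff n h‖]
    simpa using h4

/-! ### The generating series of the discrete powers -/

/-- The point `iy` of the imaginary axis. -/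
def axisPt (y : ℤ) : LatPlus := ⟨⟨0, y⟩, le_refl 0⟩

/-- The boundary axis must be traversed in both directions, hence the equivalence; from it every
point is reached by eastward steps alone. -/
theorem latPlus_induction {P : LatPlus → Prop} (h0 : P origin)
    (hn : ∀ y, P (axisPt y) ↔ P (axisPt (y + 1))) (he : ∀ z, P z → P z.east) (z : LatPlus) :
    P z := by
  have haxis : ∀ y, P (axisPt y) := fun y => by
    induction y using Int.induction_on with
    | zero => exact h0
    | succ n ih => exact (hn _).1 ih
    | pred n ih => exact (hn _).2 (by rwa [sub_add_cancel])
  obtain ⟨⟨x, y⟩, hx⟩ := z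
  have hx' : 0 ≤ x := hx
  lift x to ℕ using hx'
  induction x with
  | zero => exact haxis y
  | succ n ih =>
    have h := he _ (ih (Int.natCast_nonneg n))
    convert! h using 1

theorem alphaPlus_add_alphaMinus : alphaPlus + alphaMinus = 1 := by
  unfold alphaPlus alphaMinus; ring

theorem norm_sq_alphaPlus : ‖alphaPlus‖ ^ 2 = 1 / 2 := by
  rw [← Complex.normSq_eq_norm_sq, Complex.normSq_apply]
  simp [alphaPlus]
  norm_num

theorem conj_alphaPlus : conj alphaPlus = alphaMinus := by
  simp [alphaPlus, alphaMinus, sub_eq_add_neg, map_ofNat]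

theorem conj_alphaMinus : conj alphaMinus = alphaPlus := by
  rw [← conj_alphaPlus, Complex.conj_conj]

theorem norm_sq_alphaMinus : ‖alphaMinus‖ ^ 2 = 1 / 2 := by
  rw [← conj_alphaPlus, Complex.norm_conj, norm_sq_alphaPlus]

theorem opZ_origin (f : LatPlus → ℂ) : opZ f origin = 0 := by
  simp [opZ, integralTo, pathIntegral, stdLength, origin, LatPlus.im, LatPlus.re]

theorem opZ_east (f : LatPlus → ℂ) (z : LatPlus) : opZ f z.east = opZ f z + f z := by
  simp only [opZ, integralTo_east]
  ring

/-- The term `-f/2` in `Z` and the trapezoid weight `i/2` combine into `α₊` and `α₋`. On the axis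
this needs no analyticity, because the standard path there is purely vertical. -/
theorem opZ_axisPt_succ (f : LatPlus → ℂ) (y : ℤ) :
    opZ f (axisPt (y + 1)) + alphaMinus * f (axisPt (y + 1)) =
      opZ f (axisPt y) + alphaPlus * f (axisPt y) := by
  simp only [opZ, axisPt, integralTo_north_axis, alphaPlus, alphaMinus]
  ring

theorem zpoly_zero (z : LatPlus) : zpoly 0 z = 1 := rfl

theorem zpoly_succ (n : ℕ) : zpoly (n + 1) = opZ (zpoly n) :=
  Function.iterate_succ_apply' _ _ _

/-- The generating series `∑ₙ z⁽ⁿ⁾ tⁿ`. -/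
def genSeries (z : LatPlus) : ℂ⟦X⟧ := PowerSeries.mk fun n => zpoly n z

@[simp]
theorem coeff_genSeries (n : ℕ) (z : LatPlus) :
    PowerSeries.coeff n (genSeries z) = zpoly n z := by
  rw [genSeries, PowerSeries.coeff_mk]

theorem genSeries_origin : genSeries origin = 1 := by
  ext n
  rw [coeff_genSeries, PowerSeries.coeff_one]
  cases n with
  | zero => simp [zpoly_zero]
  | succ n => simp [zpoly_succ, opZ_origin]

theorem genSeries_east (z : LatPlus) : genSeries z.east = (1 + X) * genSeries z := by
  ext n
  have h : (1 + X : ℂ⟦X⟧) = 1 + C 1 * X := by simp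
  rw [h]
  cases n with
  | zero => rw [coeff_zero_one_add_C_mul_X_mul]; simp [zpoly_zero]
  | succ n =>
    rw [coeff_succ_one_add_C_mul_X_mul]
    simp only [coeff_genSeries, zpoly_succ, opZ_east, one_mul]

theorem genSeries_axisPt_succ (y : ℤ) :
    (1 + C alphaMinus * X) * genSeries (axisPt (y + 1)) =
      (1 + C alphaPlus * X) * genSeries (axisPt y) := by
  ext n
  cases n with
  | zero =>
    rw [coeff_zero_one_add_C_mul_X_mul, coeff_zero_one_add_C_mul_X_mul]; simp [zpoly_zero]
  | succ n =>
    rw [coeff_succ_one_add_C_mul_X_mul, coeff_succ_one_add_C_mul_X_mul]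
    simp only [coeff_genSeries, zpoly_succ, opZ_axisPt_succ]

/-- The axis relation propagates eastward because the factor `1 + X` of a horizontal step commutes
with it. -/
theorem genSeries_north (z : LatPlus) :
    (1 + C alphaMinus * X) * genSeries z.north = (1 + C alphaPlus * X) * genSeries z := by
  obtain ⟨⟨x, y⟩, hx⟩ := z
  have hx' : 0 ≤ x := hx
  lift x to ℕ using hx'
  induction x with
  | zero => exact genSeries_axisPt_succ y
  | succ n ih =>
    have h1 := ih (Int.natCast_nonneg n)
    have hz : (⟨⟨((n + 1 : ℕ) : ℤ), y⟩, hx⟩ : LatPlus) =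
        LatPlus.east ⟨⟨(n : ℤ), y⟩, Int.natCast_nonneg n⟩ := by
      simp [LatPlus.east]
    rw [hz, genSeries_east]
    have hc : ∀ w : LatPlus, w.east.north = w.north.east := fun _ => rfl
    rw [hc, genSeries_east]
    linear_combination (1 + X) * h1

/-- Makes point evaluations bounded on the Hardy space. A vertical step in either direction divides
by `1 + α₋X` or `1 + α₊X`, both harmless because their roots lie outside the closed disc. -/
theorem sqSummable_genSeries (z : LatPlus) : SqSummable (genSeries z) := by
  induction z using latPlus_induction with
  | h0 => rw [genSeries_origin]; exact sqSummable_one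
  | hn y =>
    have h := genSeries_axisPt_succ y
    constructor
    · intro hy
      refine SqSummable.of_one_add_mul norm_sq_alphaMinus ?_
      rw [h]
      exact hy.one_add_mul _
    · intro hy
      refine SqSummable.of_one_add_mul norm_sq_alphaPlus ?_
      rw [← h]
      exact hy.one_add_mul _
  | he z hz =>
    rw [genSeries_east, add_mul, one_mul]
    exact hz.add hz.X_mul

/-! ### Functions given by their coefficient series -/

/-- The function `∑ₙ φₙ z⁽ⁿ⁾`. -/
def expand (φ : ℂ⟦X⟧) (z : LatPlus) : ℂ := pairing φ (genSeries z)

/-- The power series with coefficients `f̂(n)`. -/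
def series (f : LatPlus → ℂ) : ℂ⟦X⟧ := PowerSeries.mk (coeff f)

@[simp]
theorem coeff_series (f : LatPlus → ℂ) (n : ℕ) :
    PowerSeries.coeff n (series f) = coeff f n := by
  rw [series, PowerSeries.coeff_mk]

theorem expand_one : expand 1 = fun _ => 1 := by
  funext z
  rw [expand, pairing_comm, pairing_one_right, coeff_genSeries, zpoly_zero]

theorem expand_origin (φ : ℂ⟦X⟧) : expand φ origin = PowerSeries.coeff 0 φ := by
  rw [expand, genSeries_origin, pairing_one_right]

theorem expand_add {φ ψ : ℂ⟦X⟧} (hφ : SqSummable φ) (hψ : SqSummable ψ) (z : LatPlus) :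
    expand (φ + ψ) z = expand φ z + expand ψ z :=
  pairing_add_left hφ hψ (sqSummable_genSeries z)

theorem expand_C_mul (c : ℂ) (φ : ℂ⟦X⟧) (z : LatPlus) : expand (C c * φ) z = c * expand φ z :=
  pairing_C_mul_left _ _ _

theorem expand_C (c : ℂ) (z : LatPlus) : expand (C c) z = c := by
  rw [← mul_one (C c), expand_C_mul, expand_one, mul_one]

theorem expand_X_mul_east {φ : ℂ⟦X⟧} (hφ : SqSummable φ) (z : LatPlus) :
    expand (X * φ) z.east = expand (X * φ) z + expand φ z := by
  have hz := sqSummable_genSeries z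
  unfold expand
  rw [genSeries_east, add_mul, one_mul, pairing_add_right hφ.X_mul hz hz.X_mul,
    pairing_X_mul_X_mul hφ hz]

theorem pairing_X_mul_one_add {φ u : ℂ⟦X⟧} (hφ : SqSummable φ) (hu : SqSummable u) (a : ℂ) :
    pairing (X * φ) ((1 + C a * X) * u) = pairing (X * φ) u + a * pairing φ u := by
  rw [add_mul, one_mul, mul_assoc, pairing_add_right hφ.X_mul hu (hu.X_mul.C_mul a),
    pairing_C_mul_right, pairing_X_mul_X_mul hφ hu]

theorem expand_X_mul_north {φ : ℂ⟦X⟧} (hφ : SqSummable φ) (z : LatPlus) :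
    expand (X * φ) z.north + alphaMinus * expand φ z.north =
      expand (X * φ) z + alphaPlus * expand φ z := by
  unfold expand
  rw [← pairing_X_mul_one_add hφ (sqSummable_genSeries _),
    ← pairing_X_mul_one_add hφ (sqSummable_genSeries _), genSeries_north]

theorem isDiscreteAnalytic_expand {φ : ℂ⟦X⟧} (hφ : SqSummable φ) :
    IsDiscreteAnalytic (expand φ) := by
  intro z
  have hs := sqSummable_genSeries
  have hC : (C alphaPlus + C alphaMinus : ℂ⟦X⟧) = 1 := by
    rw [← map_add, alphaPlus_add_alphaMinus, map_one]
  -- The discrete Cauchy–Riemann equation, multiplied out, is a linear relation between the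
  -- generating series at the four corners of a cell.
  have h : C alphaMinus * genSeries z.east.north + C alphaPlus * genSeries z.north =
      C alphaMinus * genSeries z + C alphaPlus * genSeries z.east := by
    have hc : z.east.north = z.north.east := rfl
    have h1 := genSeries_north z
    rw [hc, genSeries_east, genSeries_east]
    linear_combination h1 + (genSeries z.north - genSeries z) * hC
  have h2 := congrArg (pairing φ) h
  rw [pairing_add_right hφ ((hs _).C_mul _) ((hs _).C_mul _),
    pairing_add_right hφ ((hs _).C_mul _) ((hs _).C_mul _)] at h2
  simp only [pairing_C_mul_right] at h2
  have hp : (1 + Complex.I) ≠ 0 := by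
    intro h0; simpa using congrArg Complex.re h0
  have hm : (1 - Complex.I) ≠ 0 := by
    intro h0; simpa using congrArg Complex.re h0
  rw [div_eq_div_iff hp hm]
  unfold expand alphaPlus alphaMinus at *
  linear_combination 2 * h2

/-- Both sides vanish at the origin and obey the same step rules along the imaginary axis and
eastward. -/
theorem opZ_expand {φ : ℂ⟦X⟧} (hφ : SqSummable φ) : opZ (expand φ) = expand (X * φ) := by
  funext z
  induction z using latPlus_induction with
  | h0 => rw [opZ_origin, expand_origin, PowerSeries.coeff_zero_X_mul]
  | hn y =>
    have h1 := opZ_axisPt_succ (expand φ) y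
    have h2 : expand (X * φ) (axisPt (y + 1)) + _ = _ := expand_X_mul_north hφ (axisPt y)
    constructor
    · intro h
      change _ + alphaMinus * expand φ (axisPt (y + 1)) = _ at h2
      linear_combination h1 - h2 + h
    · intro h
      change _ + alphaMinus * expand φ (axisPt (y + 1)) = _ at h2
      linear_combination h2 - h1 + h
  | he z h => rw [opZ_east, expand_X_mul_east hφ, h]

theorem opZ_iterate_expand {φ : ℂ⟦X⟧} (hφ : SqSummable φ) (n : ℕ) :
    opZ^[n] (expand φ) = expand (X ^ n * φ) := by
  induction n with
  | zero => simp
  | succ n ih =>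
    rw [Function.iterate_succ_apply', ih, opZ_expand (hφ.X_pow_mul n), pow_succ', mul_assoc]

theorem zpoly_eq_expand (n : ℕ) : zpoly n = expand (X ^ n) := by
  rw [zpoly, ← expand_one, opZ_iterate_expand sqSummable_one, mul_one]

/-- The point `x` of the real axis. -/
def realPt (x : ℕ) : LatPlus := ⟨⟨(x : ℤ), 0⟩, Int.natCast_nonneg x⟩

theorem realPt_succ (x : ℕ) : realPt (x + 1) = (realPt x).east := by
  simp [realPt, LatPlus.east]

theorem zpoly_succ_realPt_succ (n x : ℕ) :
    zpoly (n + 1) (realPt (x + 1)) = zpoly (n + 1) (realPt x) + zpoly n (realPt x) := by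
  rw [realPt_succ, zpoly_succ, opZ_east]

/-- On the nonnegative real axis the discrete powers are the binomial coefficients `x choose n`.
Expansions there are therefore finite sums. -/
theorem zpoly_realPt_eq_zero {n x : ℕ} (h : x < n) : zpoly n (realPt x) = 0 := by
  induction x generalizing n with
  | zero =>
    obtain ⟨n, rfl⟩ := Nat.exists_eq_add_of_lt h
    rw [zero_add, zpoly_succ]
    exact opZ_origin _
  | succ x ih =>
    cases n with
    | zero => omega
    | succ n => rw [zpoly_succ_realPt_succ, ih (by omega), ih (by omega), add_zero]

theorem summable_mul_zpoly_realPt (a : ℕ → ℂ) (x : ℕ) (k : ℕ) :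
    Summable fun n => a n * zpoly (n + k) (realPt x) := by
  refine (hasSum_sum_of_ne_finset_zero (s := Finset.range (x + 1)) fun n hn => ?_).summable
  rw [zpoly_realPt_eq_zero (by simp at hn; omega), mul_zero]

/-- By Pascal's rule `δₓ` shifts the coefficients. Sums on the real axis being finite, no
summability of `φ` is required, so coefficients are recovered from `expand φ` for every series, even
where the sum off the axis diverges and `tsum` takes its default value. -/
theorem deltaX_iterate_expand_realPt (φ : ℂ⟦X⟧) (k x : ℕ) :
    (deltaX^[k] (expand φ)) (realPt x) =
      ∑' n, PowerSeries.coeff (n + k) φ * zpoly n (realPt x) := by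
  induction k generalizing x with
  | zero => simp [expand, pairing]
  | succ k ih =>
    have hs : ∀ x, Summable fun n => PowerSeries.coeff (n + k) φ * zpoly n (realPt x) :=
      fun x => summable_mul_zpoly_realPt _ x 0
    have hs' : Summable fun n => PowerSeries.coeff (n + 1 + k) φ * zpoly n (realPt x) :=
      summable_mul_zpoly_realPt _ x 0
    rw [Function.iterate_succ_apply', deltaX, ← realPt_succ, ih, ih,
      Summable.tsum_eq_zero_add (hs (x + 1)), Summable.tsum_eq_zero_add (hs x)]
    simp only [zpoly_succ_realPt_succ, mul_add, zpoly_zero]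
    rw [Summable.tsum_add (summable_mul_zpoly_realPt _ x 1) hs']
    rw [add_sub_add_left_eq_sub, add_sub_cancel_left]
    exact tsum_congr fun n => by rw [add_right_comm, add_assoc]

theorem series_expand (φ : ℂ⟦X⟧) : series (expand φ) = φ := by
  ext k
  rw [coeff_series]
  refine (deltaX_iterate_expand_realPt φ k 0).trans ?_
  rw [tsum_eq_single 0]
  · simp [zpoly_zero]
  · intro n hn
    rw [zpoly_realPt_eq_zero (Nat.pos_of_ne_zero hn), mul_zero]

theorem coeff_zpoly (n m : ℕ) : coeff (zpoly n) m = if m = n then 1 else 0 := by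
  rw [← coeff_series, zpoly_eq_expand, series_expand, PowerSeries.coeff_X_pow]

theorem series_zpoly (n : ℕ) : series (zpoly n) = X ^ n := by
  rw [zpoly_eq_expand, series_expand]

theorem MemH2.sqSummable {f : LatPlus → ℂ} (hf : MemH2 f) : SqSummable (series f) := by
  unfold SqSummable
  simpa only [coeff_series] using hf.summable_sq

theorem MemH2.expand_series {f : LatPlus → ℂ} (hf : MemH2 f) : expand (series f) = f := by
  funext z
  simp only [expand, pairing, coeff_series, coeff_genSeries]
  exact (hf.expansion z).tsum_eq

theorem memH2_expand {φ : ℂ⟦X⟧} (hφ : SqSummable φ) : MemH2 (expand φ) where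
  analytic := isDiscreteAnalytic_expand hφ
  summable_sq := by
    simp only [← coeff_series, series_expand]
    exact hφ
  expansion z := by
    simp only [← coeff_series, series_expand]
    have := (hφ.summable_mul (sqSummable_genSeries z)).hasSum
    simp only [coeff_genSeries] at this
    simpa only [expand, pairing, coeff_genSeries] using this

theorem mem_H2_iff {f : LatPlus → ℂ} : f ∈ H2 ↔ ∃ φ, SqSummable φ ∧ f = expand φ :=
  ⟨fun h => ⟨series f, h.sqSummable, h.expand_series.symm⟩,
    by rintro ⟨φ, hφ, rfl⟩; exact memH2_expand hφ⟩

theorem conv_eq_expand (s f : LatPlus → ℂ) : conv s f = expand (series s * series f) := by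
  funext z
  simp only [conv, expand, pairing, coeff_genSeries, PowerSeries.coeff_mul, coeff_series]
  refine tsum_congr fun n => ?_
  rw [Finset.Nat.sum_antidiagonal_eq_sum_range_succ_mk]

theorem series_conv (s f : LatPlus → ℂ) : series (conv s f) = series s * series f := by
  rw [conv_eq_expand, series_expand]

theorem series_convPow (f : LatPlus → ℂ) (k : ℕ) : series (convPow f k) = series f ^ k := by
  induction k with
  | zero => rw [convPow, ← expand_one, series_expand, pow_zero]
  | succ k ih => rw [convPow, series_conv, ih, pow_succ']

theorem h2Norm_eq (f : LatPlus → ℂ) : h2Norm f = √(sqNorm (series f)) := by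
  have : h2Inner f f = ((sqNorm (series f) : ℝ) : ℂ) := by
    rw [h2Inner, sqNorm, Complex.ofReal_tsum]
    refine tsum_congr fun n => ?_
    rw [coeff_series]
    simpa using Complex.mul_conj' (coeff f n)
  rw [h2Norm, this, Complex.ofReal_re]

theorem sqNorm_nonneg (φ : ℂ⟦X⟧) : 0 ≤ sqNorm φ := tsum_nonneg fun n => by positivity

theorem isIsometricMultiplier_iff (s : LatPlus → ℂ) :
    IsIsometricMultiplier s ↔ IsometricSeries (series s) := by
  constructor
  · intro h f hf
    obtain ⟨h1, h2⟩ := h (expand f) (memH2_expand hf)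
    rw [h2Norm_eq, h2Norm_eq, series_conv, series_expand,
      Real.sqrt_inj (sqNorm_nonneg _) (sqNorm_nonneg _)] at h2
    have h3 := MemH2.sqSummable h1
    rw [series_conv, series_expand] at h3
    exact ⟨h3, h2⟩
  · intro h f hf
    obtain ⟨φ, hφ, rfl⟩ := mem_H2_iff.1 hf
    obtain ⟨h1, h2⟩ := h φ hφ
    rw [h2Norm_eq, h2Norm_eq, series_conv, conv_eq_expand, series_expand, h2]
    exact ⟨memH2_expand h1, rfl⟩

theorem conv_image_H2 (s : LatPlus → ℂ) :
    conv s '' H2 = {f | ∃ φ, SqSummable φ ∧ f = expand (series s * φ)} := by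
  ext f
  constructor
  · rintro ⟨g, hg, rfl⟩
    exact ⟨series g, MemH2.sqSummable hg, conv_eq_expand _ _⟩
  · rintro ⟨φ, hφ, rfl⟩
    exact ⟨expand φ, memH2_expand hφ, by rw [conv_eq_expand, series_expand]⟩

/-! ### Schur functions -/

/-- The series `∑ₙ (Zⁿs)(z) tⁿ`. -/
def orbitSeries (s : LatPlus → ℂ) (z : LatPlus) : ℂ⟦X⟧ := PowerSeries.mk fun n => (opZ^[n] s) z

theorem sqSummable_orbitSeries {s : LatPlus → ℂ} {z : LatPlus}
    (h : Summable fun n : ℕ => ‖(opZ^[n] s) z‖ ^ 2) : SqSummable (orbitSeries s z) := by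
  unfold SqSummable orbitSeries
  simpa only [PowerSeries.coeff_mk] using h

theorem SqSummable.summable_mul_star {φ u : ℂ⟦X⟧} (hφ : SqSummable φ) (hu : SqSummable u) :
    Summable fun n => PowerSeries.coeff n φ * star (PowerSeries.coeff n u) := by
  refine (Summable.of_norm_bounded (hφ.summable_norm_mul hu) fun n => ?_)
  rw [norm_mul, norm_mul, norm_star]

/-- The quadratic form of a Gram matrix is the squared norm of the corresponding linear combination.
-/
theorem sum_sum_star_mul_tsum (t : Finset LatPlus) (x : LatPlus → ℂ) {u : LatPlus → ℂ⟦X⟧}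
    (hu : ∀ z, SqSummable (u z)) :
    ∑ z ∈ t, ∑ w ∈ t, star (x z) *
      (∑' n, PowerSeries.coeff n (u z) * star (PowerSeries.coeff n (u w))) * x w =
      ((sqNorm (∑ z ∈ t, C (star (x z)) * u z) : ℝ) : ℂ) := by
  rw [sqNorm, Complex.ofReal_tsum]
  have h : ∀ n, ((‖PowerSeries.coeff n (∑ z ∈ t, C (star (x z)) * u z)‖ ^ 2 : ℝ) : ℂ) =
      ∑ z ∈ t, ∑ w ∈ t, star (x z) *
        (PowerSeries.coeff n (u z) * star (PowerSeries.coeff n (u w))) * x w := by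
    intro n
    push_cast
    rw [← Complex.mul_conj', map_sum, map_sum, Finset.sum_mul_sum]
    refine Finset.sum_congr rfl fun z _ => Finset.sum_congr rfl fun w _ => ?_
    simp only [PowerSeries.coeff_C_mul, map_mul, Complex.star_def, Complex.conj_conj]
    ring
  simp only [h]
  have hs : ∀ z w, Summable fun n => star (x z) *
      (PowerSeries.coeff n (u z) * star (PowerSeries.coeff n (u w))) * x w := fun z w =>
    (((hu z).summable_mul_star (hu w)).mul_left _).mul_right _
  rw [Summable.tsum_finsetSum fun z _ => summable_sum fun w _ => hs z w]
  refine Finset.sum_congr rfl fun z _ => ?_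
  rw [Summable.tsum_finsetSum fun w _ => hs z w]
  exact Finset.sum_congr rfl fun w _ => by rw [tsum_mul_right, tsum_mul_left]

theorem schurKernel_eq {s : LatPlus → ℂ} (hs : ∀ z, SqSummable (orbitSeries s z))
    (z w : LatPlus) :
    schurKernel s z w =
      ∑' n, PowerSeries.coeff n (genSeries z) * star (PowerSeries.coeff n (genSeries w)) -
      ∑' n, PowerSeries.coeff n (orbitSeries s z) *
        star (PowerSeries.coeff n (orbitSeries s w)) := by
  rw [← Summable.tsum_sub ((sqSummable_genSeries z).summable_mul_star (sqSummable_genSeries w))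
    ((hs z).summable_mul_star (hs w))]
  simp only [schurKernel, orbitSeries, coeff_genSeries, PowerSeries.coeff_mk]

/-- Positivity of the kernel thus says that sending each `G_z` to the orbit series at `z` is
contractive on finite linear combinations. -/
theorem schurKernel_quadratic {s : LatPlus → ℂ} (hs : ∀ z, SqSummable (orbitSeries s z))
    (x : LatPlus →₀ ℂ) :
    (x.sum fun z xz => x.sum fun w xw => star xz * schurKernel s z w * xw) =
      ((sqNorm (∑ z ∈ x.support, C (star (x z)) * genSeries z) -
        sqNorm (∑ z ∈ x.support, C (star (x z)) * orbitSeries s z) : ℝ) : ℂ) := by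
  rw [Complex.ofReal_sub, ← sum_sum_star_mul_tsum _ _ sqSummable_genSeries,
    ← sum_sum_star_mul_tsum _ _ hs]
  simp only [Finsupp.sum, schurKernel_eq hs, mul_sub, sub_mul, Finset.sum_sub_distrib]

theorem schurKernel_isHermitian (s : LatPlus → ℂ) : (schurKernel s).IsHermitian := by
  ext z w
  rw [Matrix.conjTranspose_apply]
  simp only [schurKernel, tsum_star, star_sub, star_mul', star_star]
  exact tsum_congr fun n => by ring

/-- An isometric multiplier is a Schur function. -/
theorem isSchur_expand {b : ℂ⟦X⟧} (hb : IsometricSeries b) : IsSchur (expand b) := by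
  have hcoeff : ∀ n z, PowerSeries.coeff n (orbitSeries (expand b) z) =
      pairing (X ^ n * b) (genSeries z) := fun n z => by
    rw [orbitSeries, PowerSeries.coeff_mk, opZ_iterate_expand hb.sqSummable]
    rfl
  -- The `n`-th coefficient of a combination of orbit series is the pairing of `Xⁿ b` with the same
  -- combination of generating series, so the adjoint contraction bound applies.
  have key : ∀ (t : Finset LatPlus) (c : LatPlus → ℂ) (N : ℕ), ∑ n ∈ Finset.range N,
      ‖PowerSeries.coeff n (∑ z ∈ t, C (c z) * orbitSeries (expand b) z)‖ ^ 2 ≤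
      sqNorm (∑ z ∈ t, C (c z) * genSeries z) := by
    intro t c N
    have hg : ∀ z, SqSummable (C (c z) * genSeries z) := fun z => (sqSummable_genSeries z).C_mul _
    refine le_of_eq_of_le (Finset.sum_congr rfl fun n _ => ?_)
      (hb.sum_sq_pairing_le (SqSummable.sum t _ hg) N)
    rw [map_sum, pairing_sum_right t _ (hb.sqSummable.X_pow_mul n) hg]
    simp only [PowerSeries.coeff_C_mul, hcoeff, pairing_C_mul_right]
  have hs : ∀ z, SqSummable (orbitSeries (expand b) z) := fun z => by
    refine summable_of_sum_range_le (c := sqNorm (genSeries z)) (fun n => by positivity) fun N => ?_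
    simpa using key {z} (fun _ => 1) N
  refine ⟨isDiscreteAnalytic_expand hb.sqSummable, fun z => ?_, schurKernel_isHermitian _,
    fun x => ?_⟩
  · have := hs z
    unfold SqSummable orbitSeries at this
    simpa only [PowerSeries.coeff_mk] using this
  · rw [schurKernel_quadratic hs, Complex.zero_le_real, sub_nonneg]
    exact Real.tsum_le_of_sum_range_le (fun n => by positivity) fun N => key _ _ N

/-- Finite linear combinations of point evaluations. -/
def evalSpan : Submodule ℂ ((LatPlus → ℂ) → ℂ) :=
  Submodule.span ℂ (Set.range fun z : LatPlus => fun f : LatPlus → ℂ => f z)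

theorem eval_mem_evalSpan (z : LatPlus) : (fun f : LatPlus → ℂ => f z) ∈ evalSpan :=
  Submodule.subset_span ⟨z, rfl⟩

theorem deltaX_iterate_mem_evalSpan (m : ℕ) (z : LatPlus) :
    (fun f : LatPlus → ℂ => (deltaX^[m] f) z) ∈ evalSpan := by
  induction m generalizing z with
  | zero => exact eval_mem_evalSpan z
  | succ m ih =>
    simp only [Function.iterate_succ_apply']
    exact evalSpan.sub_mem (ih z.east) (ih z)

/-- Positivity gives `∑ₙ |L(Zⁿs)|² ≤ ∑ₙ |L(z⁽ⁿ⁾)|²` for every finite combination `L` of evaluations;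
only the term `n = 0` on the left is kept. -/
theorem sq_norm_evalSpan_le {s : LatPlus → ℂ} (hs : IsSchur s) {L : (LatPlus → ℂ) → ℂ}
    (hL : L ∈ evalSpan) : ‖L s‖ ^ 2 ≤ sqNorm (PowerSeries.mk fun n => L (zpoly n)) := by
  obtain ⟨c, rfl⟩ := (Finsupp.mem_span_range_iff_exists_finsupp).1 hL
  have ho : ∀ z, SqSummable (orbitSeries s z) := fun z => sqSummable_orbitSeries (hs.summable_sq z)
  set x : LatPlus →₀ ℂ := c.mapRange star (star_zero _) with hx
  have hsupp : x.support = c.support := by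
    ext z; simp [hx]
  have hxz : ∀ z, star (x z) = c z := fun z => by simp [hx]
  have h := hs.positive.2 x
  rw [schurKernel_quadratic ho, Complex.zero_le_real, sub_nonneg, hsupp] at h
  simp only [hxz] at h
  have happ : ∀ f : LatPlus → ℂ,
      (c.sum fun z a => a • fun f : LatPlus → ℂ => f z) f = ∑ z ∈ c.support, c z * f z := fun f => by
    simp [Finsupp.sum, Finset.sum_apply]
  have h1 : (PowerSeries.mk fun n => (c.sum fun z a => a • fun f : LatPlus → ℂ => f z) (zpoly n)) =
      ∑ z ∈ c.support, C (c z) * genSeries z := by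
    ext n
    simp only [PowerSeries.coeff_mk, happ, map_sum, PowerSeries.coeff_C_mul, coeff_genSeries]
  have h2 := (SqSummable.sum c.support _ fun z => (ho z).C_mul (c z)).le_tsum 0
    fun m _ => by positivity
  rw [h1]
  refine le_trans ?_ (h2.trans h)
  rw [happ]
  simp only [map_sum, PowerSeries.coeff_C_mul]
  simp [orbitSeries]

/-- A Schur function is the sum of its expansion in the discrete powers. -/
theorem IsSchur.hasSum_nat {s : LatPlus → ℂ} (hs : IsSchur s) (w : LatPlus) :
    Filter.Tendsto (fun N => ∑ m ∈ Finset.range N, coeff s m * zpoly m w) Filter.atTop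
      (nhds (s w)) := by
  have hw := sqSummable_genSeries w
  have key : ∀ N, ‖s w - ∑ m ∈ Finset.range N, coeff s m * zpoly m w‖ ^ 2 ≤
      sqNorm (genSeries w) - ∑ n ∈ Finset.range N, ‖zpoly n w‖ ^ 2 := by
    intro N
    -- The Taylor remainder at `w`. It is a finite combination of evaluations, kills `z⁽ⁿ⁾` for `n <
    -- N` and evaluates the others at `w`, so the bound is the tail of the squared norm of `G_w`.
    set L : (LatPlus → ℂ) → ℂ := fun f => f w - ∑ m ∈ Finset.range N, zpoly m w * coeff f m
    have hL : L ∈ evalSpan := by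
      have h1 : (∑ m ∈ Finset.range N, zpoly m w • fun f : LatPlus → ℂ => coeff f m) ∈ evalSpan :=
        Submodule.sum_mem _ fun m _ => evalSpan.smul_mem _ (deltaX_iterate_mem_evalSpan m origin)
      convert! evalSpan.sub_mem (eval_mem_evalSpan w) h1 using 1
      funext f
      simp [L, Finset.sum_apply]
    have hLz : ∀ n, L (zpoly n) = if n < N then 0 else zpoly n w := by
      intro n
      simp only [L, coeff_zpoly, mul_ite, mul_one, mul_zero, Finset.sum_ite_eq', Finset.mem_range]
      split_ifs <;> simp
    have h := sq_norm_evalSpan_le hs hL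
    simp only [hLz] at h
    have hLs : L s = s w - ∑ m ∈ Finset.range N, coeff s m * zpoly m w := by
      simp only [L, mul_comm]
    rw [hLs] at h
    refine h.trans (le_of_eq ?_)
    unfold sqNorm
    simp only [PowerSeries.coeff_mk, coeff_genSeries]
    unfold SqSummable at hw
    simp only [coeff_genSeries] at hw
    have hfin : Summable fun n => if n < N then ‖zpoly n w‖ ^ 2 else 0 :=
      (hasSum_sum_of_ne_finset_zero (s := Finset.range N) fun n hn => by
        rw [if_neg (by simpa using hn)]).summable
    have hsplit : ∑ n ∈ Finset.range N, ‖zpoly n w‖ ^ 2 =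
        ∑' n, if n < N then ‖zpoly n w‖ ^ 2 else 0 := by
      rw [tsum_eq_sum (s := Finset.range N) fun n hn => if_neg (by simpa using hn)]
      exact Finset.sum_congr rfl fun n hn => (if_pos (by simpa using hn)).symm
    rw [hsplit, ← Summable.tsum_sub hw hfin]
    refine tsum_congr fun n => ?_
    split_ifs <;> simp
  have hlim : Filter.Tendsto
      (fun N => sqNorm (genSeries w) - ∑ n ∈ Finset.range N, ‖zpoly n w‖ ^ 2)
      Filter.atTop (nhds 0) := by
    have h1 := (Summable.hasSum hw).tendsto_sum_nat
    simp only [coeff_genSeries] at h1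
    have h2 := h1.const_sub (sqNorm (genSeries w))
    simpa [sqNorm] using h2
  have hsq := squeeze_zero (fun N => by positivity) key hlim
  rw [tendsto_iff_norm_sub_tendsto_zero]
  have hsqrt := (Real.continuous_sqrt.tendsto 0).comp hsq
  rw [Real.sqrt_zero] at hsqrt
  refine hsqrt.congr fun N => ?_
  rw [Function.comp_apply, Real.sqrt_sq (norm_nonneg _), norm_sub_rev]

theorem IsSchur.expand_series {s : LatPlus → ℂ} (hs : IsSchur s) (h : SqSummable (series s)) :
    expand (series s) = s := by
  funext w
  have h1 := (h.summable_mul (sqSummable_genSeries w)).hasSum.tendsto_sum_nat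
  simp only [coeff_series, coeff_genSeries] at h1
  have h2 := tendsto_nhds_unique h1 (hs.hasSum_nat w)
  rw [← h2, expand, pairing]
  simp only [coeff_series, coeff_genSeries]

/-! ### The coefficients of the Blaschke factors -/

theorem series_toC : series toC = X := by
  ext n
  rw [coeff_series, PowerSeries.coeff_X, coeff]
  cases n with
  | zero => simp [toC, origin, GaussianInt.toComplex_def]
  | succ n =>
    have h : deltaX toC = expand 1 := by
      rw [expand_one]
      funext z
      simp only [deltaX, toC, east, GaussianInt.toComplex_def]
      push_cast
      ring
    rw [Function.iterate_succ_apply, h]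
    change coeff (expand 1) n = _
    rw [← coeff_series, series_expand, PowerSeries.coeff_one]
    simp

theorem series_convInvOneSub {t : ℂ} (ht : 1 + t ≠ 0) :
    series (convInvOneSub t) = PowerSeries.mk fun n => t ^ n := by
  have h : ∀ n, deltaX^[n] (convInvOneSub t) = fun z => t ^ n * genG t z := by
    intro n
    induction n with
    | zero => funext z; simp [convInvOneSub]
    | succ n ih =>
      rw [Function.iterate_succ_apply', ih]
      funext z
      have h1 : z.east.re = z.re + 1 := rfl
      have h2 : z.east.im = z.im := rfl
      simp only [deltaX, genG, h1, h2, zpow_add_one₀ ht]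
      ring
  ext n
  rw [coeff_series, PowerSeries.coeff_mk, coeff, h]
  simp [genG, origin, LatPlus.re, LatPlus.im]

theorem one_add_mul_mk_neg_pow (a : ℂ) :
    (1 + C a * X) * PowerSeries.mk (fun n => (-a) ^ n) = 1 := by
  ext n
  cases n with
  | zero => rw [coeff_zero_one_add_C_mul_X_mul]; simp
  | succ n =>
    rw [coeff_succ_one_add_C_mul_X_mul, PowerSeries.coeff_one]
    simp only [PowerSeries.coeff_mk, Nat.succ_ne_zero, if_false]
    ring

/-- Since `a ā = 1/2`, the series is `ā + (1/2) X / (1 + aX)`. Clearing the denominator gives `ā +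
X/2 + X/2`. -/
theorem one_add_mul_series_blaschkeFactor {a : ℂ} (ha : ‖a‖ ^ 2 = 1 / 2) :
    (1 + C a * X) * series (blaschkeFactor a (conj a)) = C (conj a) + X := by
  have h1 : 1 + -a ≠ 0 := by
    intro h
    rw [← sub_eq_add_neg, sub_eq_zero] at h
    rw [← h] at ha
    norm_num at ha
  set G : ℂ⟦X⟧ := PowerSeries.mk fun n => (-a) ^ n with hG
  have hG1 : (1 + C a * X) * G = 1 := one_add_mul_mk_neg_pow a
  have hGs : SqSummable G := SqSummable.of_one_add_mul ha (by rw [hG1]; exact sqSummable_one)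
  have haa : a * conj a = 1 / 2 := by
    rw [Complex.mul_conj', ← Complex.ofReal_pow, ha]
    norm_num
  have hB : blaschkeFactor a (conj a) = expand (C (conj a) + C (1 / 2) * (X * G)) := by
    funext z
    rw [expand_add (sqSummable_C _) (hGs.X_mul.C_mul _), expand_C, expand_C_mul, blaschkeFactor,
      conv_eq_expand, series_toC, series_convInvOneSub h1]
    linear_combination expand (X * G) z * haa
  rw [hB, series_expand]
  have hC1 : (C a * C (conj a) : ℂ⟦X⟧) = C (1 / 2) := by rw [← map_mul, haa]
  have hC2 : (C (1 / 2) + C (1 / 2) : ℂ⟦X⟧) = 1 := by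
    rw [← map_add]; norm_num
  linear_combination (C (1 / 2) * X) * hG1 + X * hC1 + X * hC2

/-! ### Vanishing on rectangles -/

/-- The point `x + iσj`. -/
def gridPt (σ : ℤ) (x j : ℕ) : LatPlus := ⟨⟨(x : ℤ), σ * j⟩, Int.natCast_nonneg x⟩

theorem gridPt_succ_left (σ : ℤ) (x j : ℕ) : gridPt σ (x + 1) j = (gridPt σ x j).east := by
  simp [gridPt, LatPlus.east]

theorem gridPt_zero_right (σ : ℤ) (x : ℕ) : gridPt σ x 0 = realPt x := by
  simp [gridPt, realPt]

/-- The vertical step in the direction `σ` is governed by `β`. -/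
def IsVerticalStep (σ : ℤ) (β : ℂ) : Prop :=
  ∀ g, SqSummable g → ∀ x j, expand (X * g) (gridPt σ x (j + 1)) +
    conj β * expand g (gridPt σ x (j + 1)) =
      expand (X * g) (gridPt σ x j) + β * expand g (gridPt σ x j)

theorem isVerticalStep_up : IsVerticalStep 1 alphaPlus := by
  intro g hg x j
  have h : gridPt 1 x (j + 1) = (gridPt 1 x j).north := by simp [gridPt, LatPlus.north]
  rw [h, conj_alphaPlus]
  exact expand_X_mul_north hg _

theorem isVerticalStep_down : IsVerticalStep (-1) alphaMinus := by
  intro g hg x j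
  have h : gridPt (-1) x j = (gridPt (-1) x (j + 1)).north := by simp [gridPt, LatPlus.north]
  rw [h, conj_alphaMinus]
  exact (expand_X_mul_north hg _).symm

/-- The function `∑ₙ φₙ z⁽ⁿ⁾` vanishes at the points `x + iσj` with `x ≤ p` and `j ≤ q`. -/
def VanishesOnGrid (σ : ℤ) (p q : ℕ) (φ : ℂ⟦X⟧) : Prop :=
  ∀ x ≤ p, ∀ j ≤ q, expand φ (gridPt σ x j) = 0

theorem zpoly_realPt_self (m : ℕ) : zpoly m (realPt m) = 1 := by
  induction m with
  | zero => exact zpoly_zero _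
  | succ m ih =>
    rw [zpoly_succ_realPt_succ, ih, zpoly_realPt_eq_zero m.lt_succ_self, zero_add]

/-- Evaluation at `0, …, p` is triangular in the coefficients with unit diagonal. -/
theorem vanishesOnGrid_zero_iff (σ : ℤ) (p : ℕ) (φ : ℂ⟦X⟧) :
    VanishesOnGrid σ p 0 φ ↔ X ^ (p + 1) ∣ φ := by
  rw [PowerSeries.X_pow_dvd_iff]
  simp only [VanishesOnGrid, Nat.le_zero, forall_eq, gridPt_zero_right]
  constructor
  · intro h m
    induction m using Nat.strong_induction_on with
    | _ m ih =>
      intro hm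
      have h1 := h m (by omega)
      rw [expand, pairing, tsum_eq_single m] at h1
      · simpa [zpoly_realPt_self] using h1
      · intro n hn
        rcases lt_or_gt_of_ne hn with hlt | hgt
        · rw [ih n hlt (by omega), zero_mul]
        · rw [coeff_genSeries, zpoly_realPt_eq_zero hgt, mul_zero]
  · intro h x hx
    rw [expand, pairing, ← tsum_zero (α := ℂ) (β := ℕ)]
    refine tsum_congr fun n => ?_
    rcases lt_or_ge n (p + 1) with hn | hn
    · rw [h n hn, zero_mul]
    · rw [coeff_genSeries, zpoly_realPt_eq_zero (by omega), mul_zero]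

theorem expand_C_add_X_mul {g : ℂ⟦X⟧} (hg : SqSummable g) (a : ℂ) (z : LatPlus) :
    expand ((C a + X) * g) z = a * expand g z + expand (X * g) z := by
  rw [add_mul, expand_add (hg.C_mul a) hg.X_mul, expand_C_mul]

theorem expand_one_add_mul {g : ℂ⟦X⟧} (hg : SqSummable g) (a : ℂ) (z : LatPlus) :
    expand ((1 + C a * X) * g) z = expand g z + a * expand (X * g) z := by
  rw [add_mul, one_mul, mul_assoc, expand_add hg (hg.X_mul.C_mul a), expand_C_mul]

/-- The factor `β̄ + X` is exactly the combination on the far side of the vertical step rule; the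
near side has `β` in place of `β̄`, and the mismatch is a multiple of `g` alone. -/
theorem IsVerticalStep.sub_eq {σ : ℤ} {β : ℂ} (hσ : IsVerticalStep σ β) {g : ℂ⟦X⟧}
    (hg : SqSummable g) (x j : ℕ) :
    expand ((C (conj β) + X) * g) (gridPt σ x (j + 1)) -
      expand ((C (conj β) + X) * g) (gridPt σ x j) = (β - conj β) * expand g (gridPt σ x j) := by
  rw [expand_C_add_X_mul hg, expand_C_add_X_mul hg]
  linear_combination hσ g hg x j

/-- Division by the Blaschke factor removes a row of zeros. -/
theorem exists_eq_mul_of_vanishesOnGrid_succ {σ : ℤ} {β : ℂ} (hσ : IsVerticalStep σ β)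
    (hβ : ‖β‖ ^ 2 = 1 / 2) (hne : β ≠ conj β) {b : ℂ⟦X⟧}
    (hb : (1 + C β * X) * b = C (conj β) + X) {p q : ℕ} {φ : ℂ⟦X⟧} (hφ : SqSummable φ)
    (h : VanishesOnGrid σ p (q + 1) φ) :
    ∃ ψ, SqSummable ψ ∧ VanishesOnGrid σ p q ψ ∧ φ = b * ψ := by
  have hne' : β - conj β ≠ 0 := sub_ne_zero.2 hne
  obtain ⟨g, hg, ε, rfl⟩ := hφ.exists_eq_C_add_X_mul_add_C (β := conj β)
    (by rwa [Complex.norm_conj])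
  have hsplit : ∀ z, expand ((C (conj β) + X) * g + C ε) z =
      expand ((C (conj β) + X) * g) z + ε := fun z => by
    rw [expand_add (hg.C_add_X_mul _) (sqSummable_C _), expand_C]
  have hgz : ∀ x ≤ p, ∀ j ≤ q, expand g (gridPt σ x j) = 0 := by
    intro x hx j hj
    have h1 := h x hx (j + 1) (by omega)
    have h2 := h x hx j (by omega)
    rw [hsplit] at h1 h2
    have h3 := hσ.sub_eq hg x j
    refine (mul_eq_zero.1 ?_).resolve_left hne'
    linear_combination h1 - h2 - h3
  -- At the origin both `g` and `X g` contribute nothing, so the remainder equals the value of `φ`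
  -- there.
  have hε : ε = 0 := by
    have h1 := h 0 (by omega) 0 (by omega)
    have h2 := hgz 0 (by omega) 0 (by omega)
    have h0 : expand (X * g) (gridPt σ 0 0) = 0 := by
      rw [gridPt_zero_right]
      exact (expand_origin _).trans (PowerSeries.coeff_zero_X_mul _)
    rw [hsplit, expand_C_add_X_mul hg, h2, h0] at h1
    simpa using h1
  subst hε
  refine ⟨(1 + C β * X) * g, hg.one_add_mul β, ?_, ?_⟩
  · intro x hx j hj
    have h1 := h x hx j (by omega)
    rw [hsplit, expand_C_add_X_mul hg, hgz x hx j hj] at h1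
    rw [expand_one_add_mul hg, hgz x hx j hj]
    linear_combination β * h1
  · rw [map_zero, add_zero, ← hb]
    ring

/-- Multiplication by the Blaschke factor adds a row of zeros. -/
theorem VanishesOnGrid.mul {σ : ℤ} {β : ℂ} (hσ : IsVerticalStep σ β)
    (hβ : ‖β‖ ^ 2 = 1 / 2) {b : ℂ⟦X⟧}
    (hb : (1 + C β * X) * b = C (conj β) + X) {p q : ℕ} {ψ : ℂ⟦X⟧} (hψ : SqSummable ψ)
    (h : VanishesOnGrid σ p q ψ) : VanishesOnGrid σ p (q + 1) (b * ψ) := by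
  have hβ0 : β ≠ 0 := by
    rintro rfl
    norm_num at hβ
  have hββ : β * conj β = 1 / 2 := by
    rw [Complex.mul_conj', ← Complex.ofReal_pow, hβ]
    norm_num
  obtain ⟨g, rfl⟩ : ∃ g, ψ = (1 + C β * X) * g := by
    obtain ⟨u, hu⟩ := isUnit_one_add_C_mul_X β
    exact ⟨↑u⁻¹ * ψ, by rw [← hu, Units.mul_inv_cancel_left]⟩
  have hg := hψ.of_one_add_mul hβ
  have hz : ∀ x ≤ p, ∀ j ≤ q,
      expand g (gridPt σ x j) + β * expand (X * g) (gridPt σ x j) = 0 := fun x hx j hj => by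
    rw [← expand_one_add_mul hg]
    exact h x hx j hj
  have h00 : expand g (gridPt σ 0 0) = 0 := by
    have h1 := hz 0 (by omega) 0 (by omega)
    have h0 : expand (X * g) (gridPt σ 0 0) = 0 := by
      rw [gridPt_zero_right]
      exact (expand_origin _).trans (PowerSeries.coeff_zero_X_mul _)
    rwa [h0, mul_zero, add_zero] at h1
  -- Eliminating `X g` between two consecutive rows leaves the coefficient `1 - β β̄ = 1/2` on the
  -- new value of `g`, which is nonzero.
  have hcol : ∀ j ≤ q, expand g (gridPt σ 0 j) = 0 := by
    intro j
    induction j with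
    | zero => exact fun _ => h00
    | succ j ih =>
      intro hj
      have h1 := ih (by omega)
      have h2 := hz 0 (by omega) j (by omega)
      have h3 := hz 0 (by omega) (j + 1) hj
      have h4 := hσ g hg 0 j
      have : (1 / 2 : ℂ) * expand g (gridPt σ 0 (j + 1)) = 0 := by
        linear_combination h3 - h2 - β * h4 - (β ^ 2 - 1) * h1 +
          expand g (gridPt σ 0 (j + 1)) * hββ
      simpa using this
  have hgz : ∀ x ≤ p, ∀ j ≤ q, expand g (gridPt σ x j) = 0 := by
    intro x
    induction x with
    | zero => exact fun _ => hcol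
    | succ x ih =>
      intro hx j hj
      have h1 := ih (by omega) j hj
      have h2 := hz x (by omega) j hj
      have h3 := hz (x + 1) hx j hj
      rw [gridPt_succ_left] at h3 ⊢
      have h4 := expand_X_mul_east hg (gridPt σ x j)
      linear_combination h3 - h2 - β * h4 + (1 - β) * h1
  have hprod : b * ((1 + C β * X) * g) = (C (conj β) + X) * g := by rw [← hb]; ring
  rw [hprod]
  have hlow : ∀ x ≤ p, ∀ j ≤ q, expand ((C (conj β) + X) * g) (gridPt σ x j) = 0 := by
    intro x hx j hj
    rw [expand_C_add_X_mul hg, hgz x hx j hj]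
    have h1 := hz x hx j hj
    rw [hgz x hx j hj, zero_add] at h1
    rw [(mul_eq_zero.1 h1).resolve_left hβ0]
    ring
  intro x hx j hj
  rcases Nat.lt_or_ge q j with hlt | hge
  -- The extra row: the difference from row `q` is a multiple of `g` on row `q`, where `g` vanishes.
  · obtain rfl : j = q + 1 := by omega
    have h1 := hσ.sub_eq hg x q
    rw [hlow x hx q le_rfl, hgz x hx q le_rfl] at h1
    linear_combination h1
  · exact hlow x hx j hge

theorem sqSummable_and_vanishesOnGrid_iff {σ : ℤ} {β : ℂ} (hσ : IsVerticalStep σ β)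
    (hβ : ‖β‖ ^ 2 = 1 / 2) (hne : β ≠ conj β) {b : ℂ⟦X⟧}
    (hb : (1 + C β * X) * b = C (conj β) + X) (p q : ℕ) (φ : ℂ⟦X⟧) :
    SqSummable φ ∧ VanishesOnGrid σ p q φ ↔
      ∃ ψ, SqSummable ψ ∧ φ = X ^ (p + 1) * b ^ q * ψ := by
  induction q generalizing φ with
  | zero =>
    rw [vanishesOnGrid_zero_iff]
    constructor
    · rintro ⟨hφ, ψ, rfl⟩
      exact ⟨ψ, hφ.of_X_pow_mul, by rw [pow_zero, mul_one]⟩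
    · rintro ⟨ψ, hψ, rfl⟩
      rw [pow_zero, mul_one]
      exact ⟨hψ.X_pow_mul _, dvd_mul_right _ _⟩
  | succ q ih =>
    constructor
    · rintro ⟨hφ, h⟩
      obtain ⟨ψ, hψ, hv, rfl⟩ := exists_eq_mul_of_vanishesOnGrid_succ hσ hβ hne hb hφ h
      obtain ⟨χ, hχ, rfl⟩ := (ih ψ).1 ⟨hψ, hv⟩
      exact ⟨χ, hχ, by ring⟩
    · rintro ⟨χ, hχ, rfl⟩
      obtain ⟨h1, h2⟩ := (ih _).2 ⟨χ, hχ, rfl⟩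
      have : X ^ (p + 1) * b ^ (q + 1) * χ = b * (X ^ (p + 1) * b ^ q * χ) := by ring
      rw [this]
      exact ⟨(isometricSeries_of_one_add_mul hβ hb _ h1).1, h2.mul hσ hβ hb h1⟩

/-- When `Im lam = 0` the rectangle is a single row, so the sign convention is immaterial. -/
theorem mem_rect_iff {lam z : LatPlus} {σ : ℤ} (hσ : σ = if 0 ≤ lam.im then 1 else -1) :
    z ∈ rect lam ↔ ∃ x ≤ lam.re.toNat, ∃ j ≤ lam.im.natAbs, z = gridPt σ x j := by
  obtain ⟨⟨x, y⟩, hx⟩ := z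
  obtain ⟨⟨p, q⟩, hp⟩ := lam
  have hx' : 0 ≤ x := hx
  have hp' : 0 ≤ p := hp
  change (x ≤ p ∧ |y| ≤ |q| ∧ 0 ≤ y * q) ↔ ∃ x' ≤ p.toNat, ∃ j ≤ q.natAbs, _ = gridPt σ x' j
  rw [Int.abs_eq_natAbs, Int.abs_eq_natAbs]
  have hσ' : (0 ≤ q ∧ σ = 1) ∨ (q < 0 ∧ σ = -1) := by
    rcases le_or_gt 0 q with hq | hq
    · exact Or.inl ⟨hq, hσ.trans (if_pos hq)⟩
    · exact Or.inr ⟨hq, hσ.trans (if_neg hq.not_ge)⟩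
  clear hσ
  constructor
  · rintro ⟨h1, h2, h3⟩
    refine ⟨x.toNat, by omega, y.natAbs, by omega, Subtype.ext (Zsqrtd.ext ?_ ?_)⟩
    · simp only [gridPt]
      omega
    · simp only [gridPt]
      rcases hσ' with ⟨hq, rfl⟩ | ⟨hq, rfl⟩
      · rcases hq.eq_or_lt with rfl | hq
        · omega
        · have := nonneg_of_mul_nonneg_left h3 hq
          omega
      · have : y ≤ 0 := by
          by_contra hy
          nlinarith
        omega
  · rintro ⟨x', hx', j, hj, h⟩
    have h1 : x = x' := congrArg (fun z : LatPlus => z.1.re) h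
    have h2 : y = σ * j := congrArg (fun z : LatPlus => z.1.im) h
    rcases hσ' with ⟨hq, rfl⟩ | ⟨hq, rfl⟩
    · exact ⟨by omega, by omega, mul_nonneg (by omega) hq⟩
    · exact ⟨by omega, by omega, mul_nonneg_of_nonpos_of_nonpos (by omega) hq.le⟩

/-! ### The Blaschke product of a rectangle -/

/-- The coefficient series of the Blaschke factor in the direction of `lam`. -/
def blaschkeSeries (lam : LatPlus) : ℂ⟦X⟧ :=
  X ^ (lam.re.toNat + 1) *
    series (if 0 ≤ lam.im then blaschkePlus else blaschkeMinus) ^ lam.im.natAbs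

theorem explicitBlaschke_eq_expand (lam : LatPlus) :
    explicitBlaschke lam = expand (blaschkeSeries lam) := by
  rw [explicitBlaschke, conv_eq_expand, series_zpoly, series_convPow, blaschkeSeries]

theorem one_add_mul_series_blaschkePlus :
    (1 + C alphaPlus * X) * series blaschkePlus = C (conj alphaPlus) + X := by
  rw [blaschkePlus, ← conj_alphaPlus]
  exact one_add_mul_series_blaschkeFactor norm_sq_alphaPlus

theorem one_add_mul_series_blaschkeMinus :
    (1 + C alphaMinus * X) * series blaschkeMinus = C (conj alphaMinus) + X := by
  rw [blaschkeMinus, ← conj_alphaMinus]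
  exact one_add_mul_series_blaschkeFactor norm_sq_alphaMinus

theorem isometricSeries_blaschkeSeries (lam : LatPlus) :
    IsometricSeries (blaschkeSeries lam) := by
  refine (isometricSeries_X.pow _).mul (IsometricSeries.pow ?_ _)
  split_ifs
  · exact isometricSeries_of_one_add_mul norm_sq_alphaPlus one_add_mul_series_blaschkePlus
  · exact isometricSeries_of_one_add_mul norm_sq_alphaMinus one_add_mul_series_blaschkeMinus

theorem alphaPlus_ne_alphaMinus : alphaPlus ≠ alphaMinus := by
  intro h
  have := congrArg Complex.im h
  simp [alphaPlus, alphaMinus] at this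
  norm_num at this

theorem interpolationSolutions_eq (lam : LatPlus) :
    interpolationSolutions lam =
      {f | ∃ φ, SqSummable φ ∧ f = expand (blaschkeSeries lam * φ)} := by
  obtain ⟨σ, hσ⟩ : ∃ σ : ℤ, σ = if 0 ≤ lam.im then 1 else -1 := ⟨_, rfl⟩
  have key : ∀ φ, SqSummable φ ∧ VanishesOnGrid σ lam.re.toNat lam.im.natAbs φ ↔
      ∃ ψ, SqSummable ψ ∧ φ = blaschkeSeries lam * ψ := by
    intro φ
    unfold blaschkeSeries
    split_ifs at hσ ⊢ <;> subst hσ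
    · exact sqSummable_and_vanishesOnGrid_iff isVerticalStep_up norm_sq_alphaPlus
        (by rw [conj_alphaPlus]; exact alphaPlus_ne_alphaMinus)
        one_add_mul_series_blaschkePlus _ _ _
    · exact sqSummable_and_vanishesOnGrid_iff isVerticalStep_down norm_sq_alphaMinus
        (by rw [conj_alphaMinus]; exact alphaPlus_ne_alphaMinus.symm)
        one_add_mul_series_blaschkeMinus _ _ _
  ext f
  constructor
  · rintro ⟨hf, hz⟩
    obtain ⟨φ, hφ, rfl⟩ := mem_H2_iff.1 hf
    obtain ⟨ψ, hψ, rfl⟩ := (key φ).1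
      ⟨hφ, fun x hx j hj => hz _ ((mem_rect_iff hσ).2 ⟨x, hx, j, hj, rfl⟩)⟩
    exact ⟨ψ, hψ, rfl⟩
  · rintro ⟨ψ, hψ, rfl⟩
    obtain ⟨h1, h2⟩ := (key _).2 ⟨ψ, hψ, rfl⟩
    refine ⟨memH2_expand h1, fun z hz => ?_⟩
    obtain ⟨x, hx, j, hj, rfl⟩ := (mem_rect_iff hσ).1 hz
    exact h2 x hx j hj

theorem isBlaschke_expand_C_mul (lam : LatPlus) {c : ℂ} (hc : ‖c‖ = 1) :
    IsBlaschke lam (expand (C c * blaschkeSeries lam)) := by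
  have hb := (isometricSeries_C hc).mul (isometricSeries_blaschkeSeries lam)
  have hc0 : c ≠ 0 := by
    rintro rfl
    simp at hc
  refine ⟨isSchur_expand hb, ?_, ?_⟩
  · rwa [isIsometricMultiplier_iff, series_expand]
  · rw [conv_image_H2, series_expand, interpolationSolutions_eq]
    ext f
    constructor
    · rintro ⟨φ, hφ, rfl⟩
      exact ⟨C c * φ, hφ.C_mul c, by congr 1; ring⟩
    · rintro ⟨φ, hφ, rfl⟩
      refine ⟨C c⁻¹ * φ, hφ.C_mul _, ?_⟩
      have : (C c * C c⁻¹ : ℂ⟦X⟧) = 1 := by rw [← map_mul, mul_inv_cancel₀ hc0, map_one]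
      congr 1
      linear_combination -(blaschkeSeries lam * φ) * this

/-- The image of `1` under each multiplication lies in the common range, so each series divides the
other with square-summable quotient. -/
theorem IsBlaschke.exists_eq_expand {lam : LatPlus} {B : LatPlus → ℂ} (h : IsBlaschke lam B) :
    ∃ c : ℂ, ‖c‖ = 1 ∧ B = expand (C c * blaschkeSeries lam) := by
  have hb := (isIsometricMultiplier_iff B).1 h.isometric
  have ha := isometricSeries_blaschkeSeries lam
  have hr := h.range_eq
  rw [conv_image_H2, interpolationSolutions_eq] at hr
  have inj : ∀ φ ψ : ℂ⟦X⟧, expand φ = expand ψ → φ = ψ := fun φ ψ h => by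
    rw [← series_expand φ, h, series_expand]
  obtain ⟨k, hk, hbk⟩ : expand (series B) ∈
      {f | ∃ φ, SqSummable φ ∧ f = expand (blaschkeSeries lam * φ)} := by
    rw [← hr]
    exact ⟨1, sqSummable_one, by rw [mul_one]⟩
  obtain ⟨l, hl, hal⟩ : expand (blaschkeSeries lam) ∈
      {f | ∃ φ, SqSummable φ ∧ f = expand (series B * φ)} := by
    rw [hr]
    exact ⟨1, sqSummable_one, by rw [mul_one]⟩
  obtain ⟨c, hc, hcb⟩ := eq_C_mul_of_mul_eq ha hb hk hl (inj _ _ hbk) (inj _ _ hal)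
  exact ⟨c, hc, by rw [← hcb, h.schur.expand_series hb.sqSummable]⟩

end DiscreteAnalytic

end

open DiscreteAnalytic

theorem theorem6p2 (lam : LatPlus) (B : LatPlus → ℂ) :
    IsBlaschke lam B ↔ ∃ c : ℂ, ‖c‖ = 1 ∧ B = c • explicitBlaschke lam := by
  have heq : ∀ c : ℂ, c • explicitBlaschke lam =
      expand (PowerSeries.C c * blaschkeSeries lam) := fun c => by
    funext z
    rw [expand_C_mul, explicitBlaschke_eq_expand, Pi.smul_apply, smul_eq_mul]
  simp only [heq]
  constructor
  · exact IsBlaschke.exists_eq_expand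
  · rintro ⟨c, hc, rfl⟩
    exact isBlaschke_expand_C_mul lam hc
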